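/- **Setting.** Let $Q$ be a full conjunctive query with variables $\mathbf X=\{x_1,\dots,x_n\}$, input relations $R_1,\dots,R_m$ over attribute sets $X_1,\dots,X_m\subseteq\mathbf X$, and $r$ functional dependencies $U\to y$ ($\emptyset\ne U\subseteq\mathbf X$, $y\in\mathbf X$), each of which is either guarded by some $R_j$ (then $U\cup\{y\}\subseteq X_j$ and the instance of $R_j$ satisfies it) or defined by a user-defined function $y=f(U)$ that can be evaluated in unit time. Let $L$ be the lattice of closed sets of variables, with $X\wedge Y=X\cap Y$, $X\vee Y=(X\cup Y)^+$, $\hat 0=\emptyset$, $\hat 1=\mathbf X$, where $X^+$ is the closure of $X$; write $R_j$ also for the lattice element $X_j^+$. For a chain $\mathbf C:\hat 0=C_0\prec C_1\prec\dots\prec C_k=\hat 1$ in $L$ (not necessarily maximal) let $e_j=\{i\in[k]: R_j\wedge C_i\ne R_j\wedge C_{i-1}\}$; the chain hypergraph has nodes $[k]$ and hyperedges $e_1,\dots,e_m$. The chain is good if $C_{i-1}\vee(R_j\wedge C_i)=C_i$ for all $j$ and all $i\in e_j$. A fractional edge cover is a vector $w\in\mathbb R_{\ge0}^m$ with $\sum_{j:i\in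 e_j}w_j\ge1$ for every $i\in[k]$. The *Chain Algorithm* expands every input relation to its closed attribute set by means of the dependencies (discarding tuples that violate one), indexes (sorts) the projections $\Pi_{R_j\wedge C_i}(R_j)$ in an attribute order consistent with the chain, sets $Q_0=\{()\}$, and for $i=1,\dots,k$ computes $$Q_i=\bigcup_{t\in Q_{i-1}}\ \bigcap_{j:i\in e_j}\bigl(t\Join\Pi_{R_j\wedge C_i}(R_j)\bigr)^+,$$ where for each $t$ it iterates over the tuples of the smallest of the sets $t\Join\Pi_{R_j\wedge C_i}(R_j)$ ($i\in e_j$), found by binary search, expands each of them, and verifies the result against the other $j$ with $i\in e_j$; it returns $Q_k$. Time is the number of elementary steps (accesses to data, comparisons of values, evaluations of user-defined functions). **Theorem.** Suppose that $\mathbf C$ is good and every node $i\in[k]$ belongs to some $e_j$. Then on every database instance with non-empty input relations, of cardinalities $N_j\ge1$ and total size $N=\sum_jN_j$, the Chain Algorithm computes the answer of $Q$ (without repetitions), and for every fractional edge cover $w$ of the chain hypergraph its running time is at most $$c\,(n+m+r+1)^{c}\,\bigl(1+\log_2(1+N)\bigr)\Bigl(N+\prod_{j=1}^mN_j^{w_j}\Bigr),$$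 with a universal constant $c$; that is, $\tilde O\bigl(N+\prod_jN_j^{w_j}\bigr)$, where $\tilde O$ hides one logarithmic factor and a factor polynomial in the size of the query. -/

import Mathlib

namespace ChainJoin

/-! ### Queries with functional dependencies and the lattice of closed sets -/

/-- A full conjunctive query over the variables `Fin n`, with `m` relation symbols and `r`
functional dependencies `lhs f → rhs f`.  A dependency is either guarded by a relation
(`guard f = some j`) or defined by a user-defined function (`guard f = none`). -/
structure Query (n m r : ℕ) where
  vars : Fin m → Finset (Fin n)
  lhs : Fin r → Finset (Fin n)
  rhs : Fin r → Fin n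
  guard : Fin r → Option (Fin m)
  /-- The empty set is closed, i.e. the least element of the lattice is `∅`. -/
  lhs_nonempty : ∀ f, (lhs f).Nonempty
  guard_subset : ∀ f j, guard f = some j → insert (rhs f) (lhs f) ⊆ vars j

namespace Query

variable {n m r : ℕ} (Q : Query n m r)

/-- A set of variables is closed if it is closed under all functional dependencies. -/
def IsClosed (X : Finset (Fin n)) : Prop :=
  ∀ f, Q.lhs f ⊆ X → Q.rhs f ∈ X

instance : DecidablePred Q.IsClosed := fun X =>
  inferInstanceAs (Decidable (∀ f, Q.lhs f ⊆ X → Q.rhs f ∈ X))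

/-- `X⁺`, the smallest closed set containing `X`. -/
def closure (X : Finset (Fin n)) : Finset (Fin n) :=
  Finset.univ.filter fun x => ∀ Y : Finset (Fin n), Q.IsClosed Y → X ⊆ Y → x ∈ Y

theorem mem_closure {X : Finset (Fin n)} {x : Fin n} :
    x ∈ Q.closure X ↔ ∀ Y : Finset (Fin n), Q.IsClosed Y → X ⊆ Y → x ∈ Y := by
  simp [closure]

theorem subset_closure (X : Finset (Fin n)) : X ⊆ Q.closure X := by
  intro x hx
  rw [mem_closure]
  intro Y _ hXY
  exact hXY hx

theorem closure_subset {X Y : Finset (Fin n)} (hY : Q.IsClosed Y) (h : X ⊆ Y) :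
    Q.closure X ⊆ Y := by
  intro x hx
  exact (Q.mem_closure.1 hx) Y hY h

theorem isClosed_closure (X : Finset (Fin n)) : Q.IsClosed (Q.closure X) := by
  intro f hf
  rw [mem_closure]
  intro Y hY hXY
  exact hY f (hf.trans (Q.closure_subset hY hXY))

theorem isClosed_inter {X Y : Finset (Fin n)} (hX : Q.IsClosed X) (hY : Q.IsClosed Y) :
    Q.IsClosed (X ∩ Y) := by
  intro f hf
  rw [Finset.mem_inter]
  exact ⟨hX f (hf.trans Finset.inter_subset_left), hY f (hf.trans Finset.inter_subset_right)⟩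

theorem isClosed_empty : Q.IsClosed ∅ := by
  intro f hf
  exact absurd (Finset.subset_empty.1 hf) (Q.lhs_nonempty f).ne_empty

theorem isClosed_univ : Q.IsClosed Finset.univ := fun f _ => Finset.mem_univ (Q.rhs f)

/-- The elements of the lattice of the query: the closed sets of variables. -/
def ClosedSet : Type := {X : Finset (Fin n) // Q.IsClosed X}

instance : DecidableEq Q.ClosedSet :=
  inferInstanceAs (DecidableEq {X : Finset (Fin n) // Q.IsClosed X})

/-- Closed sets ordered by inclusion; `X ∧ Y = X ∩ Y` and `X ∨ Y = (X ∪ Y)⁺`. -/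
instance : Lattice Q.ClosedSet where
  le X Y := X.1 ⊆ Y.1
  le_refl X := Finset.Subset.refl X.1
  le_trans _ _ _ h₁ h₂ := Finset.Subset.trans h₁ h₂
  le_antisymm _ _ h₁ h₂ := Subtype.ext (Finset.Subset.antisymm h₁ h₂)
  sup X Y := ⟨Q.closure (X.1 ∪ Y.1), Q.isClosed_closure _⟩
  le_sup_left X Y := Finset.subset_union_left.trans (Q.subset_closure (X.1 ∪ Y.1))
  le_sup_right X Y := Finset.subset_union_right.trans (Q.subset_closure (X.1 ∪ Y.1))
  sup_le _ _ Z h₁ h₂ := Q.closure_subset Z.2 (Finset.union_subset h₁ h₂)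
  inf X Y := ⟨X.1 ∩ Y.1, Q.isClosed_inter X.2 Y.2⟩
  inf_le_left _ _ := Finset.inter_subset_left
  inf_le_right _ _ := Finset.inter_subset_right
  le_inf _ _ _ h₁ h₂ := Finset.subset_inter h₁ h₂

instance : BoundedOrder Q.ClosedSet where
  top := ⟨Finset.univ, Q.isClosed_univ⟩
  le_top X := Finset.subset_univ X.1
  bot := ⟨∅, Q.isClosed_empty⟩
  bot_le X := Finset.empty_subset X.1

/-- The lattice element `R_j`: the closure of the attributes of the `j`-th relation. -/
def input (j : Fin m) : Q.ClosedSet := ⟨Q.closure (Q.vars j), Q.isClosed_closure _⟩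

/-- The size of the query: number of variables, relations and dependencies (plus one). -/
def size (_Q : Query n m r) : ℕ := n + m + r + 1

end Query

/-! ### Chains and the chain hypergraph -/

/-- A chain `0 = C_0 ≺ C_1 ≺ ⋯ ≺ C_k = 1`, not necessarily maximal.  The node `i ∈ [k]` is
represented by `i : Fin k`, with `C_{i-1} = C i.castSucc` and `C_i = C i.succ`. -/
structure Chain {n m r : ℕ} (Q : Query n m r) (k : ℕ) where
  set : Fin (k + 1) → Q.ClosedSet
  strictMono : StrictMono set
  set_zero : set 0 = ⊥
  set_last : set (Fin.last k) = ⊤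

namespace Chain

variable {n m r k : ℕ} {Q : Query n m r} (C : Chain Q k)

/-- `X` covers the node `i` if `X ∧ C_i ≠ X ∧ C_{i-1}`. -/
def Covers (X : Q.ClosedSet) (i : Fin k) : Prop :=
  X ⊓ C.set i.succ ≠ X ⊓ C.set i.castSucc

instance (X : Q.ClosedSet) : DecidablePred (C.Covers X) := fun i =>
  inferInstanceAs (Decidable (X ⊓ C.set i.succ ≠ X ⊓ C.set i.castSucc))

/-- The hyperedge `e_j` of the chain hypergraph. -/
def edge (j : Fin m) : Finset (Fin k) := Finset.univ.filter (C.Covers (Q.input j))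

/-- The chain is good for the `j`-th relation. -/
def IsGoodFor (j : Fin m) : Prop :=
  ∀ i ∈ C.edge j, C.set i.castSucc ⊔ (Q.input j ⊓ C.set i.succ) = C.set i.succ

/-- The chain is good for all relations of the query. -/
def IsGood : Prop := ∀ j, C.IsGoodFor j

/-- Every node of the chain hypergraph lies in some hyperedge. -/
def AllCovered : Prop := ∀ i : Fin k, ∃ j, i ∈ C.edge j

/-- `w` is a fractional edge cover of the chain hypergraph. -/
def IsFractionalEdgeCover (w : Fin m → ℝ) : Prop :=
  (∀ j, 0 ≤ w j) ∧ ∀ i : Fin k, 1 ≤ ∑ j with i ∈ C.edge j, w j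

/-- The attributes in an order consistent with the chain: first those of `C_1`, then those of
`C_2 \ C_1`, and so on. -/
def attrOrder : List (Fin n) :=
  (List.finRange k).flatMap fun i =>
    (List.finRange n).filter fun x => x ∈ (C.set i.succ).1 ∧ x ∉ (C.set i.castSucc).1

/-- The attributes of a set, in the order given by the chain. -/
def attrs (X : Q.ClosedSet) : List (Fin n) := C.attrOrder.filter fun x => x ∈ X.1

/-- The relations that cover the node `i`. -/
def covering (i : Fin k) : List (Fin m) := (List.finRange m).filter fun j => i ∈ C.edge j

end Chain

/-! ### Tuples, database instances and the answer of a query -/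

/-- A tuple over a set `X` of attributes assigns a value to the attributes in `X`, and `⊥`
("no value") to the others. -/
abbrev Tuple {n : ℕ} (Dom : Fin n → Type) : Type := (x : Fin n) → WithBot (Dom x)

section Tuples

variable {n : ℕ} {Dom : Fin n → Type}

/-- The projection of a tuple on the attributes in `X`. -/
def restrict (X : Finset (Fin n)) (t : Tuple Dom) : Tuple Dom :=
  fun x => if x ∈ X then t x else ⊥

/-- A tuple over all the attributes. -/
def ofTotal (s : (x : Fin n) → Dom x) : Tuple Dom := fun x => (s x : WithBot (Dom x))

/-- The union of two tuples (which agree on their common attributes wherever this is used). -/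
def joinTuple [∀ x, LinearOrder (Dom x)] (t s : Tuple Dom) : Tuple Dom :=
  fun x => if t x = ⊥ then s x else t x

end Tuples

/-- A database instance: for each relation symbol a finite relation over its attributes (given as
a duplicate-free list), which satisfies the dependencies that it guards, and for each unguarded
dependency a function that defines it. -/
structure Database {n m r : ℕ} (Q : Query n m r) (Dom : Fin n → Type) where
  rel : Fin m → List (Tuple Dom)
  nodup : ∀ j, (rel j).Nodup
  rel_dom : ∀ j, ∀ t ∈ rel j, ∀ x, t x ≠ ⊥ ↔ x ∈ Q.vars j
  guarded : ∀ f j, Q.guard f = some j → ∀ s ∈ rel j, ∀ t ∈ rel j,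
    (∀ x ∈ Q.lhs f, s x = t x) → s (Q.rhs f) = t (Q.rhs f)
  udf : ∀ f, Q.guard f = none → ((x : {x // x ∈ Q.lhs f}) → Dom x) → Dom (Q.rhs f)

namespace Database

variable {n m r : ℕ} {Q : Query n m r} {Dom : Fin n → Type} (D : Database Q Dom)

/-- `N_j`, the cardinality of the `j`-th relation. -/
def card (j : Fin m) : ℕ := (D.rel j).length

/-- `N = ∑_j N_j`. -/
def totalCard : ℕ := ∑ j, D.card j

/-- The answer of the query: the assignments of values to all the variables whose projections lie
in the relations and which satisfy the equations given by the user-defined functions. -/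
def answer : Set ((x : Fin n) → Dom x) :=
  {t | (∀ j, restrict (Q.vars j) (ofTotal t) ∈ D.rel j) ∧
    ∀ f (hf : Q.guard f = none), t (Q.rhs f) = D.udf f hf fun x => t x}

end Database

/-! ### Computations with a step count

One step is charged for each access to an array entry, attribute of a tuple or list cell, for each
comparison of two domain values or indices, and for each call of a user-defined function. The query,
the chain and its hypergraph are fixed parameters of the algorithm. -/

/-- A result together with the number of steps taken to compute it. -/
structure Timed (α : Type) where
  val : α
  steps : ℕ

instance : Monad Timed where
  pure a := ⟨a, 0⟩
  bind x f := ⟨(f x.val).val, x.steps + (f x.val).steps⟩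

/-- Spend `c` steps. -/
def tick (c : ℕ) : Timed Unit := ⟨(), c⟩

section Lists

variable {α β : Type}

/-- Compute and store a table with `p` entries. -/
def tabulateT {p : ℕ} (g : Fin p → Timed β) : Timed (Fin p → β) :=
  ⟨fun i => (g i).val, ∑ i, ((g i).steps + 1)⟩

def mapT (g : α → Timed β) : List α → Timed (List β)
  | [] => pure []
  | a :: l => do
    tick 1
    let b ← g a
    let l' ← mapT g l
    pure (b :: l')

def filterMapT (g : α → Timed (Option β)) : List α → Timed (List β)
  | [] => pure []
  | a :: l => do
    tick 1
    let b ← g a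
    let l' ← filterMapT g l
    match b with
    | none => pure l'
    | some b => pure (b :: l')

def flatMapT (g : α → Timed (List β)) : List α → Timed (List β)
  | [] => pure []
  | a :: l => do
    tick 1
    let b ← g a
    let l' ← flatMapT g l
    tick b.length
    pure (b ++ l')

def allT (g : α → Timed Bool) : List α → Timed Bool
  | [] => pure true
  | a :: l => do
    tick 1
    let b ← g a
    if b then allT g l else pure false

/-- An entry with the least key. -/
def argminT (key : α → ℕ) : List α → Timed (Option α)
  | [] => pure none
  | a :: l => do
    tick 1
    let b ← argminT key l
    match b with
    | none => pure (some a)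
    | some b => pure (if key a ≤ key b then some a else some b)

/-- Split a list into two halves. -/
def splitT : List α → Timed (List α × List α)
  | [] => pure ([], [])
  | a :: l => do
    tick 1
    let p ← splitT l
    pure (a :: p.2, p.1)

/-- Merge two sorted lists. -/
def mergeT (le : α → α → Timed Bool) : List α → List α → Timed (List α)
  | [], l₂ => pure l₂
  | a :: l₁, [] => pure (a :: l₁)
  | a :: l₁, b :: l₂ => do
    tick 1
    let c ← le a b
    if c then
      let l ← mergeT le l₁ (b :: l₂)
      pure (a :: l)
    else
      let l ← mergeT le (a :: l₁) l₂
      pure (b :: l)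
  termination_by l₁ l₂ => l₁.length + l₂.length

/-- Merge sort; the first argument bounds the depth of the recursion. -/
def mergeSortAux (le : α → α → Timed Bool) : ℕ → List α → Timed (List α)
  | 0, l => pure l
  | _ + 1, [] => pure []
  | _ + 1, [a] => pure [a]
  | d + 1, a :: b :: l => do
    let p ← splitT (a :: b :: l)
    let l₁ ← mergeSortAux le d p.1
    let l₂ ← mergeSortAux le d p.2
    mergeT le l₁ l₂

def mergeSortT (le : α → α → Timed Bool) (l : List α) : Timed (List α) := do
  tick l.length
  mergeSortAux le l.length l

/-- Remove duplicates from a sorted list. -/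
def dedupT (eq : α → α → Timed Bool) : List α → Timed (List α)
  | [] => pure []
  | [a] => pure [a]
  | a :: b :: l => do
    tick 1
    let c ← eq a b
    let l' ← dedupT eq (b :: l)
    if c then pure l' else pure (a :: l')

/-- Store a list in an array. -/
def toArrayT (l : List α) : Timed (Array α) := do
  tick l.length
  pure l.toArray

/-- Binary search in `a[lo], …, a[hi - 1]` for the first position where `p` fails, if `p` holds on
an initial segment. -/
def searchT (a : Array α) (p : α → Timed Bool) (lo hi : ℕ) : Timed ℕ := do
  tick 1
  if lo < hi then
    tick 1
    match a[(lo + hi) / 2]? with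
    | none => pure lo
    | some x => do
      let b ← p x
      if b then searchT a p ((lo + hi) / 2 + 1) hi else searchT a p lo ((lo + hi) / 2)
  else pure lo
  termination_by hi - lo

end Lists

/-! ### Sorted relations -/

section Index

variable {n : ℕ} {Dom : Fin n → Type} [∀ x, LinearOrder (Dom x)]

/-- Lexicographic comparison of two tuples on a list of attributes. -/
def cmpT : List (Fin n) → Tuple Dom → Tuple Dom → Timed Ordering
  | [], _, _ => pure Ordering.eq
  | x :: A, s, t => do
    tick 1
    if s x = t x then cmpT A s t
    else if s x < t x then pure Ordering.lt
    else pure Ordering.gt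

def leT (A : List (Fin n)) (s t : Tuple Dom) : Timed Bool := do
  let o ← cmpT A s t
  pure (decide (o ≠ Ordering.gt))

def ltT (A : List (Fin n)) (s t : Tuple Dom) : Timed Bool := do
  let o ← cmpT A s t
  pure (decide (o = Ordering.lt))

def eqT (A : List (Fin n)) (s t : Tuple Dom) : Timed Bool := do
  let o ← cmpT A s t
  pure (decide (o = Ordering.eq))

/-- In an array sorted by the attributes in a list that begins with `A`, the range `[lo, hi)` of
the tuples that agree with `t` on `A`, found by two binary searches. -/
def rangeT (a : Array (Tuple Dom)) (A : List (Fin n)) (t : Tuple Dom) : Timed (ℕ × ℕ) := do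
  let lo ← searchT a (fun s => ltT A s t) 0 a.size
  let hi ← searchT a (fun s => leT A s t) 0 a.size
  pure (lo, hi)

/-- The projection on `X` of a list of tuples, without duplicates and sorted by the attributes
in `A`. -/
def projectionIndexT (X : Finset (Fin n)) (A : List (Fin n)) (l : List (Tuple Dom)) :
    Timed (Array (Tuple Dom)) := do
  let l₁ ← mapT (fun t => do tick n; pure (restrict X t)) l
  let l₂ ← mergeSortT (leT A) l₁
  let l₃ ← dedupT (eqT A) l₂
  toArrayT l₃

end Index

/-! ### Expansion -/

section Expansion

variable {n m r : ℕ} {Q : Query n m r} {Dom : Fin n → Type} [∀ x, LinearOrder (Dom x)]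

/-- The attributes of the left-hand side of a dependency. -/
def lhsAttrs (Q : Query n m r) (f : Fin r) : List (Fin n) :=
  (List.finRange n).filter fun x => x ∈ Q.lhs f

/-- The relation that guards a dependency, sorted by the left-hand side of the dependency. -/
def guardIndexT (D : Database Q Dom) (f : Fin r) : Timed (Array (Tuple Dom)) :=
  match Q.guard f with
  | none => pure #[]
  | some j => do
    let l ← mergeSortT (leT (lhsAttrs Q f)) (D.rel j)
    toArrayT l

/-- The value that a dependency determines for its right-hand side: a call of the user-defined
function, or a lookup in the guard (`⊥` if there is no matching tuple). -/
def valueT (D : Database Q Dom) (G : Fin r → Array (Tuple Dom)) (f : Fin r) (t : Tuple Dom)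
    (ht : ∀ x ∈ Q.lhs f, t x ≠ ⊥) : Timed (WithBot (Dom (Q.rhs f))) :=
  match hf : Q.guard f with
  | none => do
    tick (n + 1)
    pure (D.udf f hf fun x => (t x).unbot (ht x x.2) : Dom (Q.rhs f))
  | some _ => do
    let p ← rangeT (G f) (lhsAttrs Q f) t
    tick 2
    if p.1 < p.2 then
      match (G f)[p.1]? with
      | none => pure ⊥
      | some s => pure (s (Q.rhs f))
    else pure ⊥

/-- Apply a dependency to a tuple, if the tuple has all the attributes of the left-hand side: fill
in the right-hand side, or check it if it is already there.  The tuple is discarded (`none`) if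
the guard has no matching tuple or the check fails. -/
def applyFDT (D : Database Q Dom) (G : Fin r → Array (Tuple Dom)) (f : Fin r) (t : Tuple Dom) :
    Timed (Option (Tuple Dom)) := do
  tick (n + 1)
  if ht : ∀ x ∈ Q.lhs f, t x ≠ ⊥ then
    let v ← valueT D G f t ht
    tick 3
    if v = ⊥ then pure none
    else if t (Q.rhs f) = ⊥ then
      tick n
      pure (some (Function.update t (Q.rhs f) v))
    else if t (Q.rhs f) = v then pure (some t)
    else pure none
  else pure (some t)

def applyFDsT (D : Database Q Dom) (G : Fin r → Array (Tuple Dom)) :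
    List (Fin r) → Tuple Dom → Timed (Option (Tuple Dom))
  | [], t => pure (some t)
  | f :: l, t => do
    let o ← applyFDT D G f t
    match o with
    | none => pure none
    | some t' => applyFDsT D G l t'

/-- The expansion `t⁺` of a tuple: all the dependencies are applied, `n + 1` times. -/
def expandT (D : Database Q Dom) (G : Fin r → Array (Tuple Dom)) (t : Tuple Dom) :
    Timed (Option (Tuple Dom)) :=
  applyFDsT D G (List.replicate (n + 1) (List.finRange r)).flatten t

end Expansion

/-! ### The Chain Algorithm -/

section Algorithm

variable {n m r k : ℕ} {Q : Query n m r} {Dom : Fin n → Type} [∀ x, LinearOrder (Dom x)]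

/-- Given `t ∈ Q_{i-1}` and a candidate `u ∈ (t ⋈ Π_{R_{j'} ∧ C_i}(R_{j'}))⁺`, check that
`Π_{R_j ∧ C_i}(u) ∈ Π_{R_j ∧ C_i}(R_j)` and `(t ⋈ Π_{R_j ∧ C_i}(u))⁺ = u`. -/
def verifyT (D : Database Q Dom) (C : Chain Q k) (G : Fin r → Array (Tuple Dom))
    (I : Fin m → Fin k → Array (Tuple Dom)) (i : Fin k) (t u : Tuple Dom) (j : Fin m) :
    Timed Bool := do
  let p ← rangeT (I j i) (C.attrs (Q.input j ⊓ C.set i.succ)) u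
  tick 1
  if p.1 < p.2 then
    tick (2 * n)
    let o ← expandT D G (joinTuple t (restrict (Q.input j ⊓ C.set i.succ).1 u))
    match o with
    | none => pure false
    | some u' => eqT (List.finRange n) u' u
  else pure false

/-- The set `⋂_{j : i ∈ e_j} (t ⋈ Π_{R_j ∧ C_i}(R_j))⁺` for a tuple `t ∈ Q_{i-1}`: find the `j` for
which `t ⋈ Π_{R_j ∧ C_i}(R_j)` is smallest, iterate over its tuples, expand each of them, and
verify the result against the other relations that cover `i`. -/
def extendT (D : Database Q Dom) (C : Chain Q k) (G : Fin r → Array (Tuple Dom))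
    (I : Fin m → Fin k → Array (Tuple Dom)) (i : Fin k) (t : Tuple Dom) :
    Timed (List (Tuple Dom)) := do
  let ranges ← mapT
    (fun j => do
      let p ← rangeT (I j i) (C.attrs (Q.input j ⊓ C.set i.castSucc)) t
      pure (j, p))
    (C.covering i)
  let best ← argminT (fun q : Fin m × ℕ × ℕ => q.2.2 - q.2.1) ranges
  match best with
  | none => pure []
  | some (j, lo, hi) =>
    filterMapT
      (fun q => do
        tick 1
        match (I j i)[q]? with
        | none => pure none
        | some s => do
          tick n
          let o ← expandT D G (joinTuple t s)
          match o with
          | none => pure none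
          | some u => do
            tick m
            let b ← allT (verifyT D C G I i t u) ((C.covering i).filter fun j' => j' ≠ j)
            pure (if b then some u else none))
      (List.range' lo (hi - lo))

/-- The loop over the nodes of the chain, from `Q_{i-1}` to `Q_i`. -/
def levelsT (D : Database Q Dom) (C : Chain Q k) (G : Fin r → Array (Tuple Dom))
    (I : Fin m → Fin k → Array (Tuple Dom)) :
    List (Fin k) → List (Tuple Dom) → Timed (List (Tuple Dom))
  | [], q => pure q
  | i :: is, q => do
    tick 1
    let q' ← flatMapT (extendT D C G I i) q
    levelsT D C G I is q'

/-- The Chain Algorithm: sort the guards, expand the input relations, index their projections on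
`R_j ∧ C_i` in an attribute order consistent with the chain, and compute `Q_1, …, Q_k` starting
from `Q_0 = {()}`. -/
def chainAlgorithm (D : Database Q Dom) (C : Chain Q k) : Timed (List (Tuple Dom)) := do
  let G ← tabulateT (guardIndexT D)
  let R ← tabulateT fun j => filterMapT (expandT D G) (D.rel j)
  let I ← tabulateT fun j => tabulateT fun i : Fin k =>
    projectionIndexT (Q.input j ⊓ C.set i.succ).1 (C.attrs (Q.input j ⊓ C.set i.succ)) (R j)
  levelsT D C G I (List.finRange k) [fun _ => ⊥]

end Algorithm

end ChainJoin

/-!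
The correctness of the algorithm rests on one description of expansion (`expandT_eq_some`,
`expandT_of_extends`): call a tuple consistent if it satisfies every dependency whose left-hand side
it has.  A successful expansion of `t` is a consistent extension of `t` to the closure of its
attributes, and whenever `t` has a consistent extension, the expansion is the restriction of that
extension to the closure.  Hence a consistent tuple is determined by any part of it that generates
its attributes (`eq_of_consistent`).  If the chain is good, `C_i` is generated by `C_{i-1}` and
`R_j ∧ C_i` for every `j` covering `i`; so a tuple of `Q_i` that extends `t ∈ Q_{i-1}` is determined
by its projection on `R_j ∧ C_i`, and the restriction of every answer to `C_i` is found
(`IsLevel.step`).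

The size of the levels is bounded by a potential.  Let `N_j(t)` be the number of tuples of the
expanded relation `R_j` that agree with `t` on `R_j ∧ C_i`, replaced by one if it is zero, and give
`t ∈ Q_i` the weight `∏_j N_j(t) ^ w_j`, which is at least one.  Passing from `t` to its extensions
`u ∈ Q_i`, the numbers `N_j(u)` add up to at most `N_j(t)` if `j` covers `i` and equal `N_j(t)`
otherwise; since the exponents of the covering relations add up to at least one, Hölder's inequality
(`sum_prod_rpow_le_prod_rpow`) shows that the total weight does not increase
(`sum_weight_extendT_le`).  At the start it is at most `∏_j |R_j| ^ w_j`.  The smallest candidate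
set of `t` is no larger than the weight of `t` (`le_weight`), and the work spent on `t` is
proportional to one plus this number, up to a power of the size of the query and the logarithmic
cost of a binary search.  Sorting the guards and the projections accounts for the summand `N`.
-/

namespace ChainJoin

/-! ### Results and step counts of the list operations -/

section TimedBasics

variable {α β : Type}

@[simp] theorem Timed.pure_val (a : α) : (pure a : Timed α).val = a := rfl

@[simp] theorem Timed.pure_steps (a : α) : (pure a : Timed α).steps = 0 := rfl

@[simp] theorem Timed.bind_val (x : Timed α) (f : α → Timed β) :
    (x >>= f).val = (f x.val).val := rfl

@[simp] theorem Timed.bind_steps (x : Timed α) (f : α → Timed β) :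
    (x >>= f).steps = x.steps + (f x.val).steps := rfl

@[simp] theorem tick_steps (c : ℕ) : (tick c).steps = c := rfl

theorem tabulateT_steps_le {p c : ℕ} (g : Fin p → Timed β) (h : ∀ i, (g i).steps ≤ c) :
    (tabulateT g).steps ≤ p * (c + 1) := by
  have : ∑ i, ((g i).steps + 1) ≤ ∑ _i : Fin p, (c + 1) :=
    Finset.sum_le_sum fun i _ => Nat.add_le_add_right (h i) 1
  simpa [tabulateT] using this

theorem mapT_val (g : α → Timed β) (l : List α) :
    (mapT g l).val = l.map fun a => (g a).val := by
  induction l with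
  | nil => rfl
  | cons a l ih => simp [mapT, ih]

theorem mapT_steps_le (g : α → Timed β) {c : ℕ} (l : List α) (h : ∀ a ∈ l, (g a).steps ≤ c) :
    (mapT g l).steps ≤ l.length * (c + 1) := by
  induction l with
  | nil => simp [mapT]
  | cons a l ih =>
    have h1 := h a (by simp)
    have h2 := ih fun b hb => h b (by simp [hb])
    simp only [mapT, Timed.bind_steps, tick_steps, Timed.pure_steps, List.length_cons, add_mul]
    linarith

theorem filterMapT_val (g : α → Timed (Option β)) (l : List α) :
    (filterMapT g l).val = l.filterMap fun a => (g a).val := by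
  induction l with
  | nil => rfl
  | cons a l ih =>
    rw [List.filterMap_cons, ← ih]
    simp only [filterMapT, Timed.bind_val]
    cases (g a).val <;> rfl

theorem filterMapT_steps_le (g : α → Timed (Option β)) {c : ℕ} (l : List α)
    (h : ∀ a ∈ l, (g a).steps ≤ c) : (filterMapT g l).steps ≤ l.length * (c + 1) := by
  induction l with
  | nil => simp [filterMapT]
  | cons a l ih =>
    have h1 := h a (by simp)
    have h2 := ih fun b hb => h b (by simp [hb])
    simp only [filterMapT, Timed.bind_steps, tick_steps, List.length_cons, add_mul]
    cases (g a).val <;> simp only [Timed.pure_steps] <;> linarith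

theorem flatMapT_val (g : α → Timed (List β)) (l : List α) :
    (flatMapT g l).val = l.flatMap fun a => (g a).val := by
  induction l with
  | nil => rfl
  | cons a l ih => simp [flatMapT, ih]

theorem flatMapT_steps (g : α → Timed (List β)) (l : List α) :
    (flatMapT g l).steps = (l.map fun a => 1 + (g a).steps + (g a).val.length).sum := by
  induction l with
  | nil => rfl
  | cons a l ih =>
    simp only [flatMapT, Timed.bind_steps, tick_steps, Timed.pure_steps, ih, List.map_cons,
      List.sum_cons]
    ring

theorem allT_val (g : α → Timed Bool) (l : List α) :
    (allT g l).val = l.all fun a => (g a).val := by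
  induction l with
  | nil => rfl
  | cons a l ih =>
    rw [List.all_cons, ← ih]
    simp only [allT, Timed.bind_val]
    cases (g a).val <;> rfl

theorem allT_steps_le (g : α → Timed Bool) {c : ℕ} (l : List α) (h : ∀ a ∈ l, (g a).steps ≤ c) :
    (allT g l).steps ≤ l.length * (c + 1) := by
  induction l with
  | nil => simp [allT]
  | cons a l ih =>
    have h1 := h a (by simp)
    have h2 := ih fun b hb => h b (by simp [hb])
    simp only [allT, Timed.bind_steps, tick_steps, List.length_cons, add_mul]
    cases (g a).val
    · simp only [Bool.false_eq_true, if_false, Timed.pure_steps]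
      have := Nat.zero_le (l.length * c)
      linarith
    · simp only [if_true]
      linarith

theorem argminT_val_eq_none (key : α → ℕ) {l : List α} (h : (argminT key l).val = none) :
    l = [] := by
  cases l with
  | nil => rfl
  | cons a l =>
    simp only [argminT, Timed.bind_val] at h
    cases hb : (argminT key l).val with
    | none => simp [hb] at h
    | some b =>
      rw [hb] at h
      simp only [Timed.pure_val] at h
      split_ifs at h

theorem argminT_val_eq_some (key : α → ℕ) {l : List α} {b : α}
    (h : (argminT key l).val = some b) : b ∈ l ∧ ∀ a ∈ l, key b ≤ key a := by
  induction l generalizing b with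
  | nil => simp [argminT] at h
  | cons a l ih =>
    simp only [argminT, Timed.bind_val] at h
    cases hb : (argminT key l).val with
    | none =>
      have hl := argminT_val_eq_none key hb
      simp only [hb, Timed.pure_val, Option.some.injEq] at h
      subst h hl
      simp
    | some b' =>
      rw [hb] at h
      obtain ⟨h1, h2⟩ := ih hb
      simp only [Timed.pure_val] at h
      split_ifs at h with hle
      · simp only [Option.some.injEq] at h
        subst h
        exact ⟨by simp, by simpa using fun x hx => hle.trans (h2 x hx)⟩
      · simp only [Option.some.injEq] at h
        subst h
        exact ⟨by simp [h1], by simpa using ⟨by omega, h2⟩⟩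

theorem argminT_steps (key : α → ℕ) (l : List α) : (argminT key l).steps = l.length := by
  induction l with
  | nil => rfl
  | cons a l ih =>
    simp only [argminT, Timed.bind_steps, tick_steps, ih, List.length_cons]
    cases (argminT key l).val <;> simp <;> omega

@[simp] theorem toArrayT_val (l : List α) : (toArrayT l).val = l.toArray := rfl

@[simp] theorem toArrayT_steps (l : List α) : (toArrayT l).steps = l.length := rfl

end TimedBasics

/-! ### Sorting and removal of duplicates -/

section Sorting

variable {α : Type}

theorem splitT_perm (l : List α) : ((splitT l).val.1 ++ (splitT l).val.2).Perm l := by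
  induction l with
  | nil => exact List.Perm.refl _
  | cons a l ih =>
    simp only [splitT, Timed.bind_val, Timed.pure_val, List.cons_append]
    exact (List.perm_append_comm.trans ih).cons a

theorem splitT_length (l : List α) :
    (splitT l).val.1.length = (l.length + 1) / 2 ∧ (splitT l).val.2.length = l.length / 2 := by
  induction l with
  | nil => simp [splitT]
  | cons a l ih =>
    simp only [splitT, Timed.bind_val, Timed.pure_val, List.length_cons]
    omega

theorem splitT_steps (l : List α) : (splitT l).steps = l.length := by
  induction l with
  | nil => rfl
  | cons a l ih => simp [splitT, ih, add_comm]

theorem mergeT_perm (le : α → α → Timed Bool) (l₁ l₂ : List α) :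
    (mergeT le l₁ l₂).val.Perm (l₁ ++ l₂) := by
  induction l₁, l₂ using mergeT.induct with
  | case1 l₂ => simp [mergeT]
  | case2 a l₁ => simp [mergeT]
  | case3 a l₁ b l₂ ih₁ ih₂ =>
    rw [mergeT]
    simp only [Timed.bind_val]
    split_ifs with hc
    · simpa using ih₁
    · simp only [Timed.bind_val, Timed.pure_val]
      exact (ih₂.cons b).trans List.perm_middle.symm

theorem mergeT_steps_le (le : α → α → Timed Bool) {c : ℕ} (hc : ∀ a b, (le a b).steps ≤ c)
    (l₁ l₂ : List α) :
    (mergeT le l₁ l₂).steps ≤ (l₁.length + l₂.length) * (c + 1) := by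
  induction l₁, l₂ using mergeT.induct with
  | case1 l₂ => simp [mergeT]
  | case2 a l₁ => simp [mergeT]
  | case3 a l₁ b l₂ ih₁ ih₂ =>
    rw [mergeT]
    have := hc a b
    simp only [Timed.bind_steps, tick_steps, List.length_cons] at *
    split_ifs with h
    · simp only [Timed.bind_steps, Timed.pure_steps]
      nlinarith
    · simp only [Timed.bind_steps, Timed.pure_steps]
      nlinarith

theorem mergeT_sorted (le : α → α → Timed Bool)
    (htot : ∀ a b, (le a b).val = true ∨ (le b a).val = true)
    (htrans : ∀ a b c, (le a b).val = true → (le b c).val = true → (le a c).val = true)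
    (l₁ l₂ : List α) (h₁ : l₁.Pairwise fun a b => (le a b).val = true)
    (h₂ : l₂.Pairwise fun a b => (le a b).val = true) :
    (mergeT le l₁ l₂).val.Pairwise fun a b => (le a b).val = true := by
  induction l₁, l₂ using mergeT.induct with
  | case1 l₂ => simpa [mergeT] using h₂
  | case2 a l₁ => simpa [mergeT] using h₁
  | case3 a l₁ b l₂ ih₁ ih₂ =>
    rw [mergeT]
    simp only [Timed.bind_val]
    have h₁' := List.pairwise_cons.1 h₁
    have h₂' := List.pairwise_cons.1 h₂
    split_ifs with hc
    · simp only [Timed.bind_val, Timed.pure_val]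
      refine List.pairwise_cons.2 ⟨fun x hx => ?_, ih₁ h₁'.2 h₂⟩
      rw [(mergeT_perm le l₁ (b :: l₂)).mem_iff, List.mem_append, List.mem_cons] at hx
      rcases hx with hx | rfl | hx
      · exact h₁'.1 x hx
      · exact hc
      · exact htrans _ _ _ hc (h₂'.1 x hx)
    · simp only [Timed.bind_val, Timed.pure_val]
      have hba : (le b a).val = true := (htot a b).resolve_left hc
      refine List.pairwise_cons.2 ⟨fun x hx => ?_, ih₂ h₁ h₂'.2⟩
      rw [(mergeT_perm le (a :: l₁) l₂).mem_iff, List.mem_append, List.mem_cons] at hx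
      rcases hx with (rfl | hx) | hx
      · exact hba
      · exact htrans _ _ _ hba (h₁'.1 x hx)
      · exact h₂'.1 x hx

theorem mergeSortAux_perm (le : α → α → Timed Bool) (d : ℕ) (l : List α) :
    (mergeSortAux le d l).val.Perm l := by
  induction d generalizing l with
  | zero => simp [mergeSortAux]
  | succ d ih =>
    match l with
    | [] => simp [mergeSortAux]
    | [a] => simp [mergeSortAux]
    | a :: b :: l =>
      simp only [mergeSortAux, Timed.bind_val]
      exact (mergeT_perm le _ _).trans (((ih _).append (ih _)).trans (splitT_perm _))

/-- Each split shortens a list by at least one element, so a depth of one less than the length is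
enough. -/
theorem mergeSortAux_sorted (le : α → α → Timed Bool)
    (htot : ∀ a b, (le a b).val = true ∨ (le b a).val = true)
    (htrans : ∀ a b c, (le a b).val = true → (le b c).val = true → (le a c).val = true)
    (d : ℕ) (l : List α) (hd : l.length ≤ d + 1) :
    (mergeSortAux le d l).val.Pairwise fun a b => (le a b).val = true := by
  induction d generalizing l with
  | zero =>
    match l with
    | [] => simp [mergeSortAux]
    | [a] => simp [mergeSortAux]
    | a :: b :: l => simp at hd
  | succ d ih =>
    match l with
    | [] => simp [mergeSortAux]
    | [a] => simp [mergeSortAux]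
    | a :: b :: l =>
      simp only [mergeSortAux, Timed.bind_val]
      have hlen := splitT_length (a :: b :: l)
      simp only [List.length_cons] at hlen hd
      exact mergeT_sorted le htot htrans _ _ (ih _ (by omega)) (ih _ (by omega))

/-- Lists of length at most `2 ^ e` are split at most `e` times, whatever the bound `d` on the depth
of the recursion. -/
theorem mergeSortAux_steps_le (le : α → α → Timed Bool) {c : ℕ}
    (hc : ∀ a b, (le a b).steps ≤ c) (d : ℕ) (e : ℕ) (l : List α) (hl : l.length ≤ 2 ^ e) :
    (mergeSortAux le d l).steps ≤ e * l.length * (c + 2) := by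
  induction d generalizing e l with
  | zero => simp [mergeSortAux]
  | succ d ih =>
    match l with
    | [] => simp [mergeSortAux]
    | [a] => simp [mergeSortAux]
    | a :: b :: l =>
      match e with
      | 0 => simp at hl
      | e + 1 =>
        simp only [mergeSortAux, Timed.bind_steps, splitT_steps]
        have hlen := splitT_length (a :: b :: l)
        have hp := (splitT_perm (a :: b :: l)).length_eq
        rw [List.length_append] at hp
        rw [pow_succ] at hl
        have h₁ := ih e (splitT (a :: b :: l)).val.1 (by omega)
        have h₂ := ih e (splitT (a :: b :: l)).val.2 (by omega)
        have h₃ := mergeT_steps_le le hc (mergeSortAux le d (splitT (a :: b :: l)).val.1).val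
          (mergeSortAux le d (splitT (a :: b :: l)).val.2).val
        rw [(mergeSortAux_perm le d _).length_eq, (mergeSortAux_perm le d _).length_eq, hp] at h₃
        have h₄ : e * (splitT (a :: b :: l)).val.1.length * (c + 2) +
            e * (splitT (a :: b :: l)).val.2.length * (c + 2) =
            e * (a :: b :: l).length * (c + 2) := by rw [← hp]; ring
        calc _ ≤ (a :: b :: l).length + (e * (splitT (a :: b :: l)).val.1.length * (c + 2) +
            (e * (splitT (a :: b :: l)).val.2.length * (c + 2) +
              (a :: b :: l).length * (c + 1))) := by gcongr
          _ = (a :: b :: l).length + (e * (splitT (a :: b :: l)).val.1.length * (c + 2) +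
            e * (splitT (a :: b :: l)).val.2.length * (c + 2)) +
              (a :: b :: l).length * (c + 1) := by ring
          _ = (e + 1) * (a :: b :: l).length * (c + 2) := by rw [h₄]; ring

theorem mergeSortT_perm (le : α → α → Timed Bool) (l : List α) :
    (mergeSortT le l).val.Perm l := mergeSortAux_perm le _ l

theorem mergeSortT_sorted (le : α → α → Timed Bool)
    (htot : ∀ a b, (le a b).val = true ∨ (le b a).val = true)
    (htrans : ∀ a b c, (le a b).val = true → (le b c).val = true → (le a c).val = true)
    (l : List α) : (mergeSortT le l).val.Pairwise fun a b => (le a b).val = true :=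
  mergeSortAux_sorted le htot htrans _ l (Nat.le_succ _)

theorem mergeSortT_steps_le (le : α → α → Timed Bool) {c : ℕ}
    (hc : ∀ a b, (le a b).steps ≤ c) (e : ℕ) (l : List α) (hl : l.length ≤ 2 ^ e) :
    (mergeSortT le l).steps ≤ l.length + e * l.length * (c + 2) :=
  Nat.add_le_add_left (mergeSortAux_steps_le le hc _ e l hl) _

theorem dedupT_sublist (eq : α → α → Timed Bool) (l : List α) :
    (dedupT eq l).val.Sublist l := by
  induction l with
  | nil => exact List.Sublist.refl _
  | cons a l ih =>
    match l with
    | [] => exact List.Sublist.refl _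
    | b :: l =>
      simp only [dedupT, Timed.bind_val]
      split_ifs
      · exact ih.cons a
      · exact ih.cons_cons a

theorem mem_dedupT (eq : α → α → Timed Bool) (l : List α)
    (heq : ∀ a ∈ l, ∀ b ∈ l, (eq a b).val = true → a = b) (x : α) :
    x ∈ (dedupT eq l).val ↔ x ∈ l := by
  induction l with
  | nil => rfl
  | cons a l ih =>
    match l with
    | [] => rfl
    | b :: l =>
      have ih' := ih fun a ha b hb => heq a (by simp [ha]) b (by simp [hb])
      simp only [dedupT, Timed.bind_val]
      split_ifs with hc
      · have hab := heq a (by simp) b (by simp) hc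
        simp only [Timed.pure_val, ih', hab, List.mem_cons]
        tauto
      · simp only [Timed.pure_val, List.mem_cons, ih']

/-- On a sorted list equal elements are adjacent, so no duplicates survive. -/
theorem dedupT_nodup (le : α → α → Prop) (eq : α → α → Timed Bool) (l : List α)
    (heq : ∀ a ∈ l, ∀ b ∈ l, ((eq a b).val = true ↔ a = b))
    (hanti : ∀ a ∈ l, ∀ b ∈ l, le a b → le b a → a = b) (hl : l.Pairwise le) :
    (dedupT eq l).val.Nodup := by
  induction l with
  | nil => exact List.nodup_nil
  | cons a l ih =>
    match l with
    | [] => exact List.nodup_singleton _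
    | b :: l =>
      have ih' := ih (fun a ha b hb => heq a (by simp [ha]) b (by simp [hb]))
        (fun a ha b hb => hanti a (by simp [ha]) b (by simp [hb])) (List.pairwise_cons.1 hl).2
      simp only [dedupT, Timed.bind_val]
      split_ifs with hc
      · exact ih'
      · refine List.nodup_cons.2 ⟨fun ha => ?_, ih'⟩
        have ha' := (dedupT_sublist eq _).subset ha
        have hne : a ≠ b := fun h => hc ((heq a (by simp) b (by simp)).2 h)
        have hab : le a b := (List.pairwise_cons.1 hl).1 b (by simp)
        have hba : le b a := (List.pairwise_cons.1 (List.pairwise_cons.1 hl).2).1 a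
          ((List.mem_cons.1 ha').resolve_left hne)
        exact hne (hanti a (by simp) b (by simp) hab hba)

theorem dedupT_steps_le (eq : α → α → Timed Bool) {c : ℕ} (hc : ∀ a b, (eq a b).steps ≤ c)
    (l : List α) : (dedupT eq l).steps ≤ l.length * (c + 1) := by
  induction l with
  | nil => simp [dedupT]
  | cons a l ih =>
    match l with
    | [] => simp [dedupT]
    | b :: l =>
      have h := hc a b
      rw [List.length_cons, add_mul, one_mul]
      simp only [dedupT, Timed.bind_steps, tick_steps]
      split_ifs <;> simp only [Timed.pure_steps] <;> omega

end Sorting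

/-! ### Binary search -/

section Search

variable {α : Type}

theorem searchT_steps_le (a : Array α) (p : α → Timed Bool) {c : ℕ} (hc : ∀ x, (p x).steps ≤ c)
    (d lo hi : ℕ) (hd : hi - lo < 2 ^ d) : (searchT a p lo hi).steps ≤ d * (c + 2) + 1 := by
  induction d generalizing lo hi with
  | zero =>
    rw [searchT]
    have : ¬ lo < hi := by simp at hd; omega
    simp [this]
  | succ d ih =>
    rw [searchT]
    rw [pow_succ] at hd
    simp only [Timed.bind_steps, tick_steps]
    split_ifs with hlt
    · simp only [Timed.bind_steps, tick_steps]
      cases hx : a[(lo + hi) / 2]? with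
      | none => simp only [Timed.pure_steps]; nlinarith
      | some x =>
        simp only [Timed.bind_steps]
        have h1 := hc x
        split_ifs
        · have := ih ((lo + hi) / 2 + 1) hi (by omega)
          linarith
        · have := ih lo ((lo + hi) / 2) (by omega)
          linarith
    · simp only [Timed.pure_steps]; omega

/-- Binary search finds the boundary of the initial segment on which `p` holds. -/
theorem searchT_spec (a : Array α) (p : α → Timed Bool)
    (hp : ∀ (i j : ℕ) (x y : α), i ≤ j → a[i]? = some x → a[j]? = some y → (p y).val = true →
      (p x).val = true)
    (lo hi : ℕ) (hlo : lo ≤ hi) (hhi : hi ≤ a.size)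
    (h₁ : ∀ (i : ℕ) (x : α), i < lo → a[i]? = some x → (p x).val = true)
    (h₂ : ∀ (i : ℕ) (x : α), hi ≤ i → a[i]? = some x → (p x).val = false) :
    (searchT a p lo hi).val ≤ a.size ∧
      ∀ (i : ℕ) (x : α), a[i]? = some x → ((p x).val = true ↔ i < (searchT a p lo hi).val) := by
  induction hd : hi - lo using Nat.strong_induction_on generalizing lo hi with
  | _ d ih =>
    rw [searchT]
    simp only [Timed.bind_val]
    split_ifs with hlt
    · simp only [Timed.bind_val]
      have hmid : (lo + hi) / 2 < a.size := by omega
      rw [Array.getElem?_eq_getElem hmid]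
      simp only [Timed.bind_val]
      have hsome := Array.getElem?_eq_getElem hmid
      split_ifs with hb
      · refine ih (hi - ((lo + hi) / 2 + 1)) (by omega) _ _ (by omega) hhi ?_ h₂ rfl
        intro i x hi' hx
        exact hp i _ x _ (by omega) hx hsome hb
      · refine ih ((lo + hi) / 2 - lo) (by omega) _ _ (by omega) (by omega) h₁ ?_ rfl
        intro i x hi' hx
        by_contra hne
        exact hb (hp _ i _ x hi' hsome hx (by simpa using hne))
    · simp only [Timed.pure_val]
      refine ⟨by omega, fun i x hx => ⟨fun h => ?_, fun h => h₁ i x h hx⟩⟩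
      by_contra hge
      rw [h₂ i x (by omega) hx] at h
      exact Bool.false_ne_true h

end Search

/-! ### Lexicographic order and sorted arrays of tuples -/

section Lex

variable {n : ℕ} {Dom : Fin n → Type} [∀ x, LinearOrder (Dom x)]

/-- The lexicographic preorder on tuples given by a list of attributes. -/
def LexLE (A : List (Fin n)) (s t : Tuple Dom) : Prop := (cmpT A s t).val ≠ Ordering.gt

theorem lexLE_nil (s t : Tuple Dom) : LexLE [] s t := by simp [LexLE, cmpT]

theorem lexLE_cons {x : Fin n} {A : List (Fin n)} {s t : Tuple Dom} :
    LexLE (x :: A) s t ↔ s x < t x ∨ s x = t x ∧ LexLE A s t := by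
  unfold LexLE
  simp only [cmpT, Timed.bind_val]
  split_ifs with h₁ h₂
  · simp [h₁]
  · simp [h₂]
  · simp [h₁, h₂]

theorem cmpT_eq_lt_iff {A : List (Fin n)} {s t : Tuple Dom} :
    (cmpT A s t).val = Ordering.lt ↔ ¬ LexLE A t s := by
  induction A with
  | nil => simp [cmpT, lexLE_nil]
  | cons x A ih =>
    rw [lexLE_cons]
    simp only [cmpT, Timed.bind_val]
    split_ifs with h₁ h₂
    · simp [h₁, ih]
    · simp [h₂.not_gt, h₂.ne']
    · have h₃ : t x < s x := lt_of_le_of_ne (not_lt.1 h₂) (Ne.symm h₁)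
      simp [h₃]

theorem cmpT_eq_eq_iff {A : List (Fin n)} {s t : Tuple Dom} :
    (cmpT A s t).val = Ordering.eq ↔ ∀ x ∈ A, s x = t x := by
  induction A with
  | nil => simp [cmpT]
  | cons x A ih =>
    simp only [cmpT, Timed.bind_val, List.forall_mem_cons]
    split_ifs with h₁ h₂
    · simp [h₁, ih]
    · simp [h₁]
    · simp [h₁]

theorem LexLE.trans {A : List (Fin n)} {s t u : Tuple Dom} (h₁ : LexLE A s t)
    (h₂ : LexLE A t u) : LexLE A s u := by
  induction A with
  | nil => exact lexLE_nil _ _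
  | cons x A ih =>
    rw [lexLE_cons] at *
    rcases h₁ with h₁ | ⟨h₁, h₁'⟩ <;> rcases h₂ with h₂ | ⟨h₂, h₂'⟩
    · exact Or.inl (h₁.trans h₂)
    · exact Or.inl (h₂ ▸ h₁)
    · exact Or.inl (h₁ ▸ h₂)
    · exact Or.inr ⟨h₁.trans h₂, ih h₁' h₂'⟩

theorem LexLE.total (A : List (Fin n)) (s t : Tuple Dom) : LexLE A s t ∨ LexLE A t s := by
  by_contra! h
  have := cmpT_eq_lt_iff.2 h.2
  exact h.1 (by simp [LexLE, this])

theorem LexLE.antisymm {A : List (Fin n)} {s t : Tuple Dom} (h₁ : LexLE A s t)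
    (h₂ : LexLE A t s) : ∀ x ∈ A, s x = t x := by
  rw [← cmpT_eq_eq_iff]
  have h₃ : (cmpT A s t).val ≠ Ordering.lt := fun h => cmpT_eq_lt_iff.1 h h₂
  unfold LexLE at h₁
  cases h : (cmpT A s t).val <;> simp_all

theorem LexLE.of_append {A B : List (Fin n)} {s t : Tuple Dom} (h : LexLE (A ++ B) s t) :
    LexLE A s t := by
  induction A with
  | nil => exact lexLE_nil _ _
  | cons x A ih =>
    rw [List.cons_append, lexLE_cons] at h
    rw [lexLE_cons]
    exact h.imp_right fun h => ⟨h.1, ih h.2⟩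

theorem cmpT_congr {A : List (Fin n)} {s t t' : Tuple Dom} (h : ∀ x ∈ A, t x = t' x) :
    cmpT A s t = cmpT A s t' := by
  induction A with
  | nil => rfl
  | cons x A ih =>
    rw [List.forall_mem_cons] at h
    simp only [cmpT, h.1, ih h.2]

theorem cmpT_steps_le (A : List (Fin n)) (s t : Tuple Dom) : (cmpT A s t).steps ≤ A.length := by
  induction A with
  | nil => simp [cmpT]
  | cons x A ih =>
    simp only [cmpT, Timed.bind_steps, tick_steps, List.length_cons]
    split_ifs
    · omega
    · simp
    · simp

theorem leT_val {A : List (Fin n)} {s t : Tuple Dom} : (leT A s t).val = true ↔ LexLE A s t := by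
  simp [leT, LexLE]

theorem ltT_val {A : List (Fin n)} {s t : Tuple Dom} :
    (ltT A s t).val = true ↔ ¬ LexLE A t s := by
  simp [ltT, cmpT_eq_lt_iff]

theorem eqT_val {A : List (Fin n)} {s t : Tuple Dom} :
    (eqT A s t).val = true ↔ ∀ x ∈ A, s x = t x := by
  simp [eqT, cmpT_eq_eq_iff]

theorem leT_steps_le (A : List (Fin n)) (s t : Tuple Dom) : (leT A s t).steps ≤ A.length :=
  cmpT_steps_le A s t

theorem ltT_steps_le (A : List (Fin n)) (s t : Tuple Dom) : (ltT A s t).steps ≤ A.length :=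
  cmpT_steps_le A s t

theorem eqT_steps_le (A : List (Fin n)) (s t : Tuple Dom) : (eqT A s t).steps ≤ A.length :=
  cmpT_steps_le A s t

theorem lexLE_of_getElem? {a : Array (Tuple Dom)} {A : List (Fin n)}
    (ha : a.toList.Pairwise (LexLE A)) {i j : ℕ} {x y : Tuple Dom} (hij : i ≤ j)
    (hx : a[i]? = some x) (hy : a[j]? = some y) : LexLE A x y := by
  rcases hij.eq_or_lt with rfl | hij
  · obtain rfl : x = y := by simpa [hx] using hy
    exact (LexLE.total A x x).elim id id
  · obtain ⟨hi, rfl⟩ := Array.getElem?_eq_some_iff.1 hx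
    obtain ⟨hj, rfl⟩ := Array.getElem?_eq_some_iff.1 hy
    exact List.pairwise_iff_getElem.1 ha i j (by simpa) (by simpa) hij

/-- In an array sorted by `A ++ B`, the range computed for `A` consists of the positions of the
tuples that agree with the given one on `A`. -/
theorem mem_rangeT (a : Array (Tuple Dom)) (A B : List (Fin n)) (t : Tuple Dom)
    (ha : a.toList.Pairwise (LexLE (A ++ B))) {i : ℕ} {s : Tuple Dom} (hs : a[i]? = some s) :
    ((rangeT a A t).val.1 ≤ i ∧ i < (rangeT a A t).val.2) ↔ ∀ x ∈ A, s x = t x := by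
  have hmono : ∀ {i j : ℕ} {x y : Tuple Dom}, i ≤ j → a[i]? = some x → a[j]? = some y →
      LexLE A x y := lexLE_of_getElem? (ha.imp LexLE.of_append)
  have h₁ := (searchT_spec a (fun s => ltT A s t)
    (fun i j x y hij hx hy h => by
      rw [ltT_val] at h ⊢
      exact fun h' => h (h'.trans (hmono hij hx hy)))
    0 a.size (Nat.zero_le _) le_rfl (fun i _ hi => absurd hi (Nat.not_lt_zero i))
    (fun i x hi hx => by
      rw [Array.getElem?_eq_none hi] at hx
      exact absurd hx (by simp))).2 i s hs
  have h₂ := (searchT_spec a (fun s => leT A s t)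
    (fun i j x y hij hx hy h => by
      rw [leT_val] at h ⊢
      exact (hmono hij hx hy).trans h)
    0 a.size (Nat.zero_le _) le_rfl (fun i _ hi => absurd hi (Nat.not_lt_zero i))
    (fun i x hi hx => by
      rw [Array.getElem?_eq_none hi] at hx
      exact absurd hx (by simp))).2 i s hs
  rw [ltT_val] at h₁
  rw [leT_val] at h₂
  simp only [rangeT, Timed.bind_val, Timed.pure_val]
  rw [← h₂, ← not_lt, ← h₁, not_not]
  exact ⟨fun h => h.2.antisymm h.1, fun h =>
    ⟨by simp [LexLE, cmpT_eq_eq_iff.2 fun x hx => (h x hx).symm],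
      by simp [LexLE, cmpT_eq_eq_iff.2 h]⟩⟩

theorem rangeT_snd_le (a : Array (Tuple Dom)) (A : List (Fin n)) (t : Tuple Dom)
    (ha : a.toList.Pairwise (LexLE A)) : (rangeT a A t).val.2 ≤ a.size := by
  exact (searchT_spec a (fun s => leT A s t)
    (fun i j x y hij hx hy h => by
      rw [leT_val] at h ⊢
      exact (lexLE_of_getElem? ha hij hx hy).trans h)
    0 a.size (Nat.zero_le _) le_rfl (fun i _ hi => absurd hi (Nat.not_lt_zero i))
    (fun i x hi hx => by
      rw [Array.getElem?_eq_none hi] at hx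
      exact absurd hx (by simp))).1

theorem rangeT_congr (a : Array (Tuple Dom)) {A : List (Fin n)} {t t' : Tuple Dom}
    (h : ∀ x ∈ A, t x = t' x) : rangeT a A t = rangeT a A t' := by
  simp only [rangeT, ltT, leT, cmpT_congr h]

theorem rangeT_steps_le (a : Array (Tuple Dom)) (A : List (Fin n)) (t : Tuple Dom) {d : ℕ}
    (hd : a.size < 2 ^ d) : (rangeT a A t).steps ≤ 2 * (d * (A.length + 2) + 1) := by
  have h₁ := searchT_steps_le a (fun s => ltT A s t) (fun s => ltT_steps_le A s t) d 0 a.size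
    (by simpa using hd)
  have h₂ := searchT_steps_le a (fun s => leT A s t) (fun s => leT_steps_le A s t) d 0 a.size
    (by simpa using hd)
  simp only [rangeT, Timed.bind_steps, Timed.pure_steps]
  omega

theorem mergeSortT_leT_sorted (A : List (Fin n)) (l : List (Tuple Dom)) :
    (mergeSortT (leT A) l).val.Pairwise (LexLE A) := by
  have := mergeSortT_sorted (leT A) (fun a b => by simpa only [leT_val] using LexLE.total A a b)
    (fun a b c => by simpa only [leT_val] using LexLE.trans) l
  simpa only [leT_val] using this

section ProjectionIndex

variable (X : Finset (Fin n)) (A : List (Fin n)) (l : List (Tuple Dom))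

theorem projectionIndexT_toList : (projectionIndexT X A l).val.toList =
    (dedupT (eqT A) (mergeSortT (leT A) (l.map (restrict X))).val).val := by
  simp [projectionIndexT, mapT_val]

theorem projectionIndexT_sorted : (projectionIndexT X A l).val.toList.Pairwise (LexLE A) := by
  rw [projectionIndexT_toList]
  exact (mergeSortT_leT_sorted A _).sublist (dedupT_sublist _ _)

variable {X A}

theorem eq_of_mem_map_restrict (hA : ∀ x ∈ X, x ∈ A) {s t : Tuple Dom}
    (hs : s ∈ (mergeSortT (leT A) (l.map (restrict X))).val)
    (ht : t ∈ (mergeSortT (leT A) (l.map (restrict X))).val) (h : ∀ x ∈ A, s x = t x) :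
    s = t := by
  rw [(mergeSortT_perm _ _).mem_iff, List.mem_map] at hs ht
  obtain ⟨s, -, rfl⟩ := hs
  obtain ⟨t, -, rfl⟩ := ht
  funext x
  by_cases hx : x ∈ X
  · exact h x (hA x hx)
  · simp [restrict, hx]

theorem mem_projectionIndexT (hA : ∀ x ∈ X, x ∈ A) {s : Tuple Dom} :
    s ∈ (projectionIndexT X A l).val.toList ↔ ∃ t ∈ l, restrict X t = s := by
  rw [projectionIndexT_toList, mem_dedupT _ _ fun a ha b hb h =>
    eq_of_mem_map_restrict l hA ha hb (eqT_val.1 h), (mergeSortT_perm _ _).mem_iff, List.mem_map]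

theorem projectionIndexT_nodup (hA : ∀ x ∈ X, x ∈ A) :
    (projectionIndexT X A l).val.toList.Nodup := by
  rw [projectionIndexT_toList]
  refine dedupT_nodup (LexLE A) _ _ (fun a ha b hb => ?_) (fun a ha b hb h₁ h₂ => ?_)
    (mergeSortT_leT_sorted A _)
  · rw [eqT_val]
    exact ⟨eq_of_mem_map_restrict l hA ha hb, fun h x _ => by rw [h]⟩
  · exact eq_of_mem_map_restrict l hA ha hb (h₁.antisymm h₂)

variable (X A)

theorem projectionIndexT_size_le : (projectionIndexT X A l).val.size ≤ l.length := by
  rw [← Array.length_toList, projectionIndexT_toList]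
  refine (dedupT_sublist _ _).length_le.trans ?_
  rw [(mergeSortT_perm _ _).length_eq, List.length_map]

theorem projectionIndexT_steps_le {d : ℕ} (hd : l.length ≤ 2 ^ d) :
    (projectionIndexT X A l).steps ≤
      l.length * (n + 1) + (l.length + d * l.length * (A.length + 2)) +
        l.length * (A.length + 1) + l.length := by
  have h₁ := mapT_steps_le (c := n) (fun t : Tuple Dom => do tick n; pure (restrict X t)) l
    (fun a _ => by simp)
  have h₂ := mergeSortT_steps_le (leT A) (leT_steps_le A) d (l.map (restrict X)) (by simpa)
  have h₃ := dedupT_steps_le (eqT A) (eqT_steps_le A) (mergeSortT (leT A) (l.map (restrict X))).val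
  have h₄ := (dedupT_sublist (eqT A) (mergeSortT (leT A) (l.map (restrict X))).val).length_le
  rw [(mergeSortT_perm _ _).length_eq] at h₃ h₄
  rw [List.length_map] at h₂ h₃ h₄
  have h₅ : (mapT (fun t : Tuple Dom => do tick n; pure (restrict X t)) l).val =
      l.map (restrict X) := mapT_val _ _
  simp only [projectionIndexT, Timed.bind_steps, toArrayT_steps, h₅]
  omega

end ProjectionIndex

end Lex

/-! ### Expansion of tuples -/

section TupleOrder

variable {n : ℕ} {Dom : Fin n → Type}

/-- The tuple `u` extends `t`: it agrees with `t` on the attributes of `t`. -/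
def Extends (t u : Tuple Dom) : Prop := ∀ x, t x ≠ ⊥ → u x = t x

theorem Extends.refl (t : Tuple Dom) : Extends t t := fun _ _ => rfl

theorem Extends.trans {t u v : Tuple Dom} (h₁ : Extends t u) (h₂ : Extends u v) : Extends t v :=
  fun x hx => by rw [h₂ x (by rwa [h₁ x hx]), h₁ x hx]

theorem restrict_extends (X : Finset (Fin n)) (t : Tuple Dom) : Extends (restrict X t) t := by
  intro x hx
  by_cases h : x ∈ X
  · simp [restrict, h]
  · simp [restrict, h] at hx

theorem restrict_eq_iff {X : Finset (Fin n)} {s t : Tuple Dom} :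
    restrict X s = restrict X t ↔ ∀ x ∈ X, s x = t x := by
  refine ⟨fun h x hx => by simpa [restrict, hx] using congrFun h x, fun h => ?_⟩
  funext x
  by_cases hx : x ∈ X
  · simp [restrict, hx, h x hx]
  · simp [restrict, hx]

theorem restrict_apply_of_mem {X : Finset (Fin n)} {t : Tuple Dom} {x : Fin n} (hx : x ∈ X) :
    restrict X t x = t x := by simp [restrict, hx]

variable [∀ x, LinearOrder (Dom x)]

/-- The set of attributes to which a tuple assigns a value. -/
def support (t : Tuple Dom) : Finset (Fin n) := Finset.univ.filter fun x => t x ≠ ⊥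

@[simp] theorem mem_support {t : Tuple Dom} {x : Fin n} : x ∈ support t ↔ t x ≠ ⊥ := by
  simp [support]

theorem Extends.support_subset {t u : Tuple Dom} (h : Extends t u) : support t ⊆ support u := by
  intro x hx
  rw [mem_support] at *
  rwa [h x hx]

theorem Extends.eq_restrict {t u : Tuple Dom} (h : Extends t u) :
    t = restrict (support t) u := by
  funext x
  by_cases hx : t x = ⊥
  · simp [restrict, hx]
  · simp [restrict, hx, h x hx]

theorem support_restrict {X : Finset (Fin n)} {t : Tuple Dom} (h : X ⊆ support t) :
    support (restrict X t) = X := by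
  ext x
  rw [mem_support]
  by_cases hx : x ∈ X
  · simpa [restrict, hx] using mem_support.1 (h hx)
  · simp [restrict, hx]

theorem joinTuple_extends {t s u : Tuple Dom} (ht : Extends t u) (hs : Extends s u) :
    Extends (joinTuple t s) u := by
  intro x hx
  by_cases h : t x = ⊥
  · simp only [joinTuple, h, if_true] at hx ⊢
    exact hs x hx
  · simp only [joinTuple, h, if_false]
    exact ht x h

theorem extends_joinTuple (t s : Tuple Dom) : Extends t (joinTuple t s) := by
  intro x hx
  simp [joinTuple, hx]

theorem support_joinTuple (t s : Tuple Dom) :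
    support (joinTuple t s) = support t ∪ support s := by
  ext x
  by_cases h : t x = ⊥ <;> simp [joinTuple, h]

end TupleOrder

section ExpansionSpec

variable {n m r : ℕ} {Q : Query n m r} {Dom : Fin n → Type} [∀ x, LinearOrder (Dom x)]
variable (D : Database Q Dom) (G : Fin r → Array (Tuple Dom))

theorem mem_lhsAttrs {f : Fin r} {x : Fin n} : x ∈ lhsAttrs Q f ↔ x ∈ Q.lhs f := by
  simp [lhsAttrs]

theorem valueT_of_guard_eq_none {f : Fin r} (hf : Q.guard f = none) (t : Tuple Dom)
    (ht : ∀ x ∈ Q.lhs f, t x ≠ ⊥) : valueT D G f t ht = (do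
      tick (n + 1)
      pure (D.udf f hf fun x => (t x).unbot (ht x x.2) : Dom (Q.rhs f))) := by
  unfold valueT
  split
  · rfl
  · simp_all

theorem valueT_of_guard_eq_some {f : Fin r} {j : Fin m} (hf : Q.guard f = some j)
    (t : Tuple Dom) (ht : ∀ x ∈ Q.lhs f, t x ≠ ⊥) : valueT D G f t ht = (do
      let p ← rangeT (G f) (lhsAttrs Q f) t
      tick 2
      if p.1 < p.2 then
        match (G f)[p.1]? with
        | none => pure ⊥
        | some s => pure (s (Q.rhs f))
      else pure ⊥) := by
  unfold valueT
  split
  · simp_all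
  · rfl

/-- The value found for a dependency depends only on its left-hand side. -/
theorem valueT_congr {f : Fin r} {t t' : Tuple Dom} (ht : ∀ x ∈ Q.lhs f, t x ≠ ⊥)
    (ht' : ∀ x ∈ Q.lhs f, t' x ≠ ⊥) (h : ∀ x ∈ Q.lhs f, t x = t' x) :
    valueT D G f t ht = valueT D G f t' ht' := by
  cases hf : Q.guard f with
  | none =>
    rw [valueT_of_guard_eq_none D G hf, valueT_of_guard_eq_none D G hf]
    have : (fun x : {x // x ∈ Q.lhs f} => (t x).unbot (ht x x.2)) =
        fun x : {x // x ∈ Q.lhs f} => (t' x).unbot (ht' x x.2) := by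
      funext x
      simp only [h x x.2]
    rw [this]
  | some j =>
    rw [valueT_of_guard_eq_some D G hf, valueT_of_guard_eq_some D G hf,
      rangeT_congr (G f) fun x hx => h x (mem_lhsAttrs.1 hx)]

/-- The tuple has all attributes of the dependency and satisfies it, as far as the user-defined
function or the sorted guard tells. -/
def Satisfies (f : Fin r) (u : Tuple Dom) : Prop :=
  ∃ hu : ∀ x ∈ Q.lhs f, u x ≠ ⊥, (valueT D G f u hu).val = u (Q.rhs f) ∧ u (Q.rhs f) ≠ ⊥

/-- The tuple satisfies all dependencies whose left-hand side it has; in particular its support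
is closed. -/
def Consistent (u : Tuple Dom) : Prop := ∀ f, Q.lhs f ⊆ support u → Satisfies D G f u

variable {D G}

theorem Satisfies.of_extends {f : Fin r} {t u : Tuple Dom} (h : Satisfies D G f t)
    (htu : Extends t u) : Satisfies D G f u := by
  obtain ⟨ht, h₁, h₂⟩ := h
  have hu : ∀ x ∈ Q.lhs f, u x = t x := fun x hx => htu x (ht x hx)
  refine ⟨fun x hx => by rw [hu x hx]; exact ht x hx, ?_, ?_⟩
  · rw [valueT_congr D G _ ht hu, h₁, htu _ h₂]
  · rwa [htu _ h₂]

theorem Consistent.isClosed {u : Tuple Dom} (h : Consistent D G u) : Q.IsClosed (support u) :=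
  fun f hf => by
    obtain ⟨_, _, h₂⟩ := h f hf
    exact mem_support.2 h₂

/-- A consistent tuple restricts to a consistent tuple on every closed set. -/
theorem Consistent.restrict {u : Tuple Dom} (h : Consistent D G u) {X : Finset (Fin n)}
    (hX : Q.IsClosed X) (hXu : X ⊆ support u) : Consistent D G (restrict X u) := by
  intro f hf
  rw [support_restrict hXu] at hf
  obtain ⟨hu, h₁, h₂⟩ := h f (hf.trans hXu)
  have hl : ∀ x ∈ Q.lhs f, ChainJoin.restrict X u x = u x := fun x hx =>
    restrict_apply_of_mem (hf hx)
  refine ⟨fun x hx => by rw [hl x hx]; exact hu x hx, ?_, ?_⟩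
  · rw [valueT_congr D G _ hu hl, h₁, restrict_apply_of_mem (hX f hf)]
  · rwa [restrict_apply_of_mem (hX f hf)]

theorem applyFDT_eq_some {f : Fin r} {t t' : Tuple Dom}
    (h : (applyFDT D G f t).val = some t') :
    Extends t t' ∧ (∀ Y, Q.IsClosed Y → support t ⊆ Y → support t' ⊆ Y) ∧
      (Q.lhs f ⊆ support t → Satisfies D G f t') := by
  unfold applyFDT at h
  rw [Timed.bind_val] at h
  by_cases ht : ∀ x ∈ Q.lhs f, t x ≠ ⊥
  · rw [dif_pos ht, Timed.bind_val, Timed.bind_val] at h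
    by_cases hv : (valueT D G f t ht).val = ⊥
    · simp [hv] at h
    rw [if_neg hv] at h
    by_cases hr : t (Q.rhs f) = ⊥
    · simp only [hr, if_true, Timed.bind_val, Timed.pure_val, Option.some.injEq] at h
      have hext : Extends t t' := by
        intro x hx
        rw [← h, Function.update_of_ne (by rintro rfl; exact hx hr)]
      have hrhs : t' (Q.rhs f) = (valueT D G f t ht).val := by rw [← h, Function.update_self]
      refine ⟨hext, fun Y hY htY x hx => ?_, fun hf => ?_⟩
      · by_cases hxf : x = Q.rhs f
        · rw [hxf]
          exact hY f fun y hy => htY (mem_support.2 (ht y hy))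
        · rw [mem_support, ← h, Function.update_of_ne hxf] at hx
          exact htY (mem_support.2 hx)
      · have hu : ∀ x ∈ Q.lhs f, t' x = t x := fun x hx => hext x (ht x hx)
        refine ⟨fun x hx => by rw [hu x hx]; exact ht x hx, ?_, by rwa [hrhs]⟩
        rw [valueT_congr D G _ ht hu, hrhs]
    · rw [if_neg hr] at h
      by_cases hr' : t (Q.rhs f) = (valueT D G f t ht).val
      · rw [if_pos hr', Timed.pure_val, Option.some.injEq] at h
        subst h
        exact ⟨Extends.refl _, fun _ _ h => h, fun _ => ⟨ht, hr'.symm, hr⟩⟩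
      · simp [hr'] at h
  · rw [dif_neg ht, Timed.pure_val, Option.some.injEq] at h
    subst h
    exact ⟨Extends.refl _, fun _ _ h => h, fun hf =>
      absurd (fun x hx => mem_support.1 (hf hx)) ht⟩

theorem exists_applyFDT_eq_some {f : Fin r} {t v : Tuple Dom} (htv : Extends t v)
    (hv : Consistent D G v) : ∃ t', (applyFDT D G f t).val = some t' ∧ Extends t' v := by
  unfold applyFDT
  rw [Timed.bind_val]
  by_cases ht : ∀ x ∈ Q.lhs f, t x ≠ ⊥
  · have hl : ∀ x ∈ Q.lhs f, v x = t x := fun x hx => htv x (ht x hx)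
    obtain ⟨hv', h₁, h₂⟩ := hv f fun x hx => mem_support.2 (by rw [hl x hx]; exact ht x hx)
    rw [valueT_congr D G hv' ht hl] at h₁
    rw [dif_pos ht, Timed.bind_val, Timed.bind_val, h₁, if_neg h₂]
    by_cases hr : t (Q.rhs f) = ⊥
    · rw [if_pos hr]
      refine ⟨_, rfl, fun x hx => ?_⟩
      by_cases hxf : x = Q.rhs f
      · subst hxf
        rw [Function.update_self]
      · rw [Function.update_of_ne hxf] at hx ⊢
        exact htv x hx
    · rw [if_neg hr, if_pos (htv _ hr).symm]
      exact ⟨_, rfl, htv⟩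
  · rw [dif_neg ht]
    exact ⟨_, rfl, htv⟩

theorem applyFDsT_eq_some {l : List (Fin r)} {t t' : Tuple Dom}
    (h : (applyFDsT D G l t).val = some t') :
    Extends t t' ∧ (∀ Y, Q.IsClosed Y → support t ⊆ Y → support t' ⊆ Y) ∧
      ∀ f ∈ l, Q.lhs f ⊆ support t → Satisfies D G f t' := by
  induction l generalizing t with
  | nil =>
    simp only [applyFDsT, Timed.pure_val, Option.some.injEq] at h
    subst h
    exact ⟨Extends.refl _, fun _ _ h => h, by simp⟩
  | cons f l ih =>
    simp only [applyFDsT, Timed.bind_val] at h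
    cases ho : (applyFDT D G f t).val with
    | none => simp [ho] at h
    | some t₁ =>
      rw [ho] at h
      obtain ⟨h₁, h₂, h₃⟩ := applyFDT_eq_some ho
      obtain ⟨h₄, h₅, h₆⟩ := ih h
      refine ⟨h₁.trans h₄, fun Y hY htY => h₅ Y hY (h₂ Y hY htY), fun g hg hgt => ?_⟩
      rcases List.mem_cons.1 hg with rfl | hg
      · exact (h₃ hgt).of_extends h₄
      · exact h₆ g hg (hgt.trans h₁.support_subset)

theorem exists_applyFDsT_eq_some {l : List (Fin r)} {t v : Tuple Dom} (htv : Extends t v)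
    (hv : Consistent D G v) : ∃ t', (applyFDsT D G l t).val = some t' ∧ Extends t' v := by
  induction l generalizing t with
  | nil => exact ⟨t, rfl, htv⟩
  | cons f l ih =>
    obtain ⟨t₁, h₁, h₂⟩ := exists_applyFDT_eq_some (f := f) htv hv
    simp only [applyFDsT, Timed.bind_val, h₁]
    exact ih h₂

theorem applyFDsT_append (l₁ l₂ : List (Fin r)) (t : Tuple Dom) :
    (applyFDsT D G (l₁ ++ l₂) t).val =
      (applyFDsT D G l₁ t).val.bind fun t' => (applyFDsT D G l₂ t').val := by
  induction l₁ generalizing t with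
  | nil => rfl
  | cons f l ih =>
    simp only [List.cons_append, applyFDsT, Timed.bind_val]
    cases (applyFDT D G f t).val with
    | none => rfl
    | some t₁ => exact ih t₁

/-- A round that adds no attribute has checked all dependencies, so after `p` rounds the tuple is
consistent or at least `p` attributes have been added. -/
theorem consistent_or_card_le {p : ℕ} {t t' : Tuple Dom}
    (h : (applyFDsT D G (List.replicate p (List.finRange r)).flatten t).val = some t') :
    Consistent D G t' ∨ p + (support t).card ≤ (support t').card := by
  induction p generalizing t with
  | zero => exact Or.inr (by simpa using Finset.card_le_card (applyFDsT_eq_some h).1.support_subset)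
  | succ p ih =>
    rw [List.replicate_succ, List.flatten_cons, applyFDsT_append] at h
    obtain ⟨t₁, ht₁, h⟩ := Option.bind_eq_some_iff.1 h
    obtain ⟨h₁, -, h₃⟩ := applyFDsT_eq_some ht₁
    obtain ⟨h₄, h₅, -⟩ := applyFDsT_eq_some h
    by_cases hs : support t₁ ⊆ support t
    · have hsat : ∀ f, Q.lhs f ⊆ support t → Satisfies D G f t₁ := fun f hf =>
        h₃ f (List.mem_finRange f) hf
      have hcl : Q.IsClosed (support t) := fun f hf => by
        obtain ⟨_, _, h⟩ := hsat f hf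
        exact hs (mem_support.2 h)
      exact Or.inl fun f hf => (hsat f (hf.trans (h₅ _ hcl hs))).of_extends h₄
    · have hlt := Finset.card_lt_card (Finset.ssubset_iff_subset_ne.2
        ⟨h₁.support_subset, fun h => hs h.symm.subset⟩)
      exact (ih h).imp_right fun h => by omega

/-- A successful expansion is a consistent extension to the closure of the support. -/
theorem expandT_eq_some {t u : Tuple Dom} (h : (expandT D G t).val = some u) :
    Extends t u ∧ support u = Q.closure (support t) ∧ Consistent D G u := by
  obtain ⟨h₁, h₂, -⟩ := applyFDsT_eq_some h
  have hc : Consistent D G u := (consistent_or_card_le h).resolve_right fun hle => by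
    have := Finset.card_le_univ (support u)
    rw [Fintype.card_fin] at this
    omega
  exact ⟨h₁, Finset.Subset.antisymm (h₂ _ (Q.isClosed_closure _) (Q.subset_closure _))
    (Q.closure_subset hc.isClosed h₁.support_subset), hc⟩

/-- Expansion succeeds on every tuple that has a consistent extension. -/
theorem expandT_of_extends {t v : Tuple Dom} (htv : Extends t v) (hv : Consistent D G v) :
    (expandT D G t).val = some (restrict (Q.closure (support t)) v) := by
  obtain ⟨u, hu, huv⟩ := exists_applyFDsT_eq_some
    (l := (List.replicate (n + 1) (List.finRange r)).flatten) htv hv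
  have hu' : (expandT D G t).val = some u := hu
  rw [hu', ← (expandT_eq_some hu').2.1, ← huv.eq_restrict]

/-- A consistent tuple is determined by any part of it whose attributes generate its support. -/
theorem eq_of_consistent {t u v : Tuple Dom} (hu : Consistent D G u) (hv : Consistent D G v)
    (htu : Extends t u) (htv : Extends t v) (hsu : support u = Q.closure (support t))
    (hsv : support v = Q.closure (support t)) : u = v := by
  have h₁ := expandT_of_extends htu hu
  have h₂ := expandT_of_extends htv hv
  have h₃ := (Extends.refl u).eq_restrict
  have h₄ := (Extends.refl v).eq_restrict
  rw [hsu] at h₃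
  rw [hsv] at h₄
  rw [h₃, h₄]
  exact Option.some.inj (h₁.symm.trans h₂)

end ExpansionSpec

/-! ### The guards and the answer of the query -/

section Answer

variable {n m r : ℕ} {Q : Query n m r} {Dom : Fin n → Type} [∀ x, LinearOrder (Dom x)]
variable (D : Database Q Dom)

/-- The sorted guards. -/
def guardIndex (f : Fin r) : Array (Tuple Dom) := (guardIndexT D f).val

/-- The expanded `j`-th relation. -/
def expanded (j : Fin m) : List (Tuple Dom) :=
  (D.rel j).filterMap fun t => (expandT D (guardIndex D) t).val

theorem guardIndex_toList {f : Fin r} {j : Fin m} (hf : Q.guard f = some j) :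
    (guardIndex D f).toList = (mergeSortT (leT (lhsAttrs Q f)) (D.rel j)).val := by
  simp [guardIndex, guardIndexT, hf]

theorem guardIndex_size_le (f : Fin r) : (guardIndex D f).size ≤ D.totalCard := by
  rw [← Array.length_toList]
  cases hf : Q.guard f with
  | none => simp [guardIndex, guardIndexT, hf]
  | some j =>
    rw [guardIndex_toList D hf, (mergeSortT_perm _ _).length_eq]
    exact Finset.single_le_sum (f := D.card) (fun _ _ => Nat.zero_le _) (Finset.mem_univ j)

variable {D}

theorem satisfies_guard {f : Fin r} {j : Fin m} (hf : Q.guard f = some j) {u : Tuple Dom}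
    (hu : restrict (Q.vars j) u ∈ D.rel j) : Satisfies D (guardIndex D) f u := by
  have hsub := Q.guard_subset f j hf
  have hbot : ∀ x ∈ Q.vars j, u x ≠ ⊥ := fun x hx => by
    have := (D.rel_dom j _ hu x).2 hx
    rwa [restrict_apply_of_mem hx] at this
  have hl : ∀ x ∈ Q.lhs f, x ∈ Q.vars j := fun x hx => hsub (Finset.mem_insert_of_mem hx)
  have hr : Q.rhs f ∈ Q.vars j := hsub (Finset.mem_insert_self _ _)
  refine ⟨fun x hx => hbot x (hl x hx), ?_, hbot _ hr⟩
  rw [valueT_of_guard_eq_some D _ hf]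
  simp only [Timed.bind_val]
  have hsort : (guardIndex D f).toList.Pairwise (LexLE (lhsAttrs Q f ++ [])) := by
    rw [List.append_nil, guardIndex_toList D hf]
    exact mergeSortT_leT_sorted _ _
  have hmem : ∀ s : Tuple Dom, s ∈ (guardIndex D f).toList ↔ s ∈ D.rel j := fun s => by
    rw [guardIndex_toList D hf, (mergeSortT_perm _ _).mem_iff]
  obtain ⟨i, hi, hi'⟩ := List.mem_iff_getElem.1 ((hmem _).2 hu)
  have hsome : (guardIndex D f)[i]? = some (restrict (Q.vars j) u) := by
    rw [← Array.getElem?_toList, List.getElem?_eq_getElem hi, hi']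
  have hrange := (mem_rangeT _ _ [] u hsort hsome).2 fun x hx =>
    restrict_apply_of_mem (hl x (mem_lhsAttrs.1 hx))
  have hlt := hrange.1.trans_lt hrange.2
  have hi'' : i < (guardIndex D f).size := by rw [← Array.length_toList]; exact hi
  have hsome' := Array.getElem?_eq_getElem (hrange.1.trans_lt hi'')
  rw [if_pos hlt, hsome']
  have hagree := (mem_rangeT _ _ [] u hsort hsome').1 ⟨le_rfl, hlt⟩
  have hs := (hmem _).1 (Array.getElem_mem_toList (hrange.1.trans_lt hi''))
  have := D.guarded f j hf _ hs _ hu fun x hx => by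
    rw [hagree x (mem_lhsAttrs.2 hx), restrict_apply_of_mem (hl x hx)]
  rw [Timed.pure_val, this, restrict_apply_of_mem hr]

theorem satisfies_udf_iff {f : Fin r} (hf : Q.guard f = none) (t : (x : Fin n) → Dom x)
    (G : Fin r → Array (Tuple Dom)) :
    Satisfies D G f (ofTotal t) ↔ t (Q.rhs f) = D.udf f hf fun x => t x := by
  have hb : ∀ x ∈ Q.lhs f, ofTotal t x ≠ ⊥ := fun x _ => WithBot.coe_ne_bot
  have hval : (valueT D G f (ofTotal t) hb).val = ((D.udf f hf fun x => t x : Dom (Q.rhs f)) :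
      WithBot (Dom (Q.rhs f))) := by
    rw [valueT_of_guard_eq_none D G hf]
    rfl
  refine ⟨fun ⟨_, h, _⟩ => ?_, fun h => ⟨hb, ?_, WithBot.coe_ne_bot⟩⟩
  · rw [hval] at h
    exact (WithBot.coe_injective h).symm
  · rw [hval, ← h]
    rfl

theorem support_ofTotal (t : (x : Fin n) → Dom x) : support (ofTotal t) = Finset.univ := by
  ext x
  simp [ofTotal]

theorem consistent_of_mem_answer {t : (x : Fin n) → Dom x} (ht : t ∈ D.answer) :
    Consistent D (guardIndex D) (ofTotal t) := by
  intro f _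
  cases hf : Q.guard f with
  | none => exact (satisfies_udf_iff hf t _).2 (ht.2 f hf)
  | some j => exact satisfies_guard hf (ht.1 j)

theorem support_of_mem_rel {j : Fin m} {t : Tuple Dom} (ht : t ∈ D.rel j) :
    support t = Q.vars j := by
  ext x
  rw [mem_support, D.rel_dom j t ht]

theorem support_of_mem_expanded {j : Fin m} {s : Tuple Dom} (hs : s ∈ expanded D j) :
    support s = (Q.input j).1 := by
  obtain ⟨t, ht, hts⟩ := List.mem_filterMap.1 hs
  rw [(expandT_eq_some hts).2.1, support_of_mem_rel ht]
  rfl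

theorem restrict_mem_rel_of_mem_expanded {j : Fin m} {s : Tuple Dom} (hs : s ∈ expanded D j) :
    restrict (Q.vars j) s ∈ D.rel j := by
  obtain ⟨t, ht, hts⟩ := List.mem_filterMap.1 hs
  rw [← support_of_mem_rel ht, ← (expandT_eq_some hts).1.eq_restrict]
  exact ht

theorem restrict_mem_expanded {t : (x : Fin n) → Dom x} (ht : t ∈ D.answer) (j : Fin m) :
    restrict (Q.input j).1 (ofTotal t) ∈ expanded D j := by
  refine List.mem_filterMap.2 ⟨_, ht.1 j, ?_⟩
  rw [expandT_of_extends (restrict_extends _ _) (consistent_of_mem_answer ht),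
    support_of_mem_rel (ht.1 j)]
  rfl

theorem expanded_length_le (D : Database Q Dom) (j : Fin m) :
    (expanded D j).length ≤ D.card j := List.length_filterMap_le _ _

end Answer

/-! ### Attribute orders consistent with the chain -/

namespace Chain

variable {n m r k : ℕ} {Q : Query n m r} (C : Chain Q k)

theorem subset_of_le {i j : Fin (k + 1)} (h : i ≤ j) : (C.set i).1 ⊆ (C.set j).1 :=
  C.strictMono.monotone h

theorem mem_attrOrder (x : Fin n) : x ∈ C.attrOrder := by
  by_contra hx
  simp only [attrOrder, List.mem_flatMap, List.mem_finRange, List.mem_filter, true_and,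
    decide_eq_true_eq, not_exists, not_and, not_not] at hx
  have h : ∀ i : Fin (k + 1), x ∉ (C.set i).1 := by
    intro i
    induction i using Fin.induction with
    | zero =>
      rw [C.set_zero]
      exact Finset.notMem_empty x
    | succ i ih => exact fun hi => ih (hx i hi)
  have hlast := h (Fin.last k)
  rw [C.set_last] at hlast
  exact hlast (Finset.mem_univ x)

theorem mem_attrs {X : Q.ClosedSet} {x : Fin n} : x ∈ C.attrs X ↔ x ∈ X.1 := by
  simp [attrs, C.mem_attrOrder]

theorem attrOrder_nodup : C.attrOrder.Nodup := by
  refine List.pairwise_flatMap.2 ⟨fun i _ => (List.nodup_finRange n).filter _, ?_⟩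
  refine (List.pairwise_lt_finRange k).imp fun {i j} hij x hx y hy => ?_
  simp only [List.mem_filter, decide_eq_true_eq] at hx hy
  rintro rfl
  exact hy.2.2 (C.subset_of_le (Fin.succ_le_castSucc_iff.2 hij) hx.2.1)

theorem attrs_length_le (X : Q.ClosedSet) : (C.attrs X).length ≤ n := by
  have := (C.attrOrder_nodup.filter fun x => x ∈ X.1).length_le_card
  simpa [attrs] using this

/-- The attributes of `C_i` precede all other attributes. -/
theorem attrOrder_pairwise (i : Fin (k + 1)) :
    C.attrOrder.Pairwise fun x y => y ∈ (C.set i).1 → x ∈ (C.set i).1 := by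
  have key : ∀ j : Fin k, ∀ y, y ∉ (C.set j.castSucc).1 → y ∈ (C.set i).1 → j.succ ≤ i := by
    intro j y hy hyi
    by_contra hlt
    exact hy (C.subset_of_le (Fin.le_castSucc_iff.2 (not_le.1 hlt)) hyi)
  refine List.pairwise_flatMap.2 ⟨fun j _ => ?_, ?_⟩
  · refine List.pairwise_of_forall_mem_list fun x hx y hy hyi => ?_
    simp only [List.mem_filter, decide_eq_true_eq] at hx hy
    exact C.subset_of_le (key j y hy.2.2 hyi) hx.2.1
  · refine (List.pairwise_lt_finRange k).imp fun {j j'} hij x hx y hy hyi => ?_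
    simp only [List.mem_filter, decide_eq_true_eq] at hx hy
    exact C.subset_of_le ((Fin.succ_le_succ_iff.2 hij.le).trans (key j' y hy.2.2 hyi)) hx.2.1

end Chain

/-- If the elements with the property `q` precede all others, filtering splits the list into an
initial and a final segment. -/
theorem filter_append_filter_not_of_pairwise {α : Type} (q : α → Prop) [DecidablePred q]
    {l : List α} (h : l.Pairwise fun a b => q b → q a) :
    (l.filter fun a => q a) ++ (l.filter fun a => ¬ q a) = l := by
  induction l with
  | nil => rfl
  | cons a l ih =>
    obtain ⟨h₁, h₂⟩ := List.pairwise_cons.1 h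
    by_cases ha : q a
    · simpa [ha] using ih h₂
    · have hl : (l.filter fun a => q a) = [] :=
        List.filter_eq_nil_iff.2 fun b hb hqb => ha (h₁ b hb (by simpa using hqb))
      have := ih h₂
      rw [hl, List.nil_append] at this
      simp only [ha, hl, this, List.filter_cons, decide_false, decide_true, not_false_eq_true,
        if_true, Bool.false_eq_true, if_false, List.nil_append]

namespace Chain

variable {n m r k : ℕ} {Q : Query n m r} (C : Chain Q k)

/-- The order of the attributes of `X ∧ C_i` begins with that of `X ∧ C_{i-1}`, so an index on
the former also serves to search by the latter. -/
theorem exists_attrs_eq_append (X : Q.ClosedSet) (i : Fin k) :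
    ∃ B, C.attrs (X ⊓ C.set i.succ) = C.attrs (X ⊓ C.set i.castSucc) ++ B := by
  refine ⟨(C.attrs (X ⊓ C.set i.succ)).filter fun x => ¬ x ∈ (C.set i.castSucc).1,
    (filter_append_filter_not_of_pairwise (fun x => x ∈ (C.set i.castSucc).1)
      ((C.attrOrder_pairwise i.castSucc).sublist List.filter_sublist)).symm.trans ?_⟩
  congr 1
  unfold attrs
  rw [List.filter_filter]
  refine List.filter_congr fun x _ => ?_
  have h₁ : x ∈ (X ⊓ C.set i.castSucc).1 ↔ x ∈ X.1 ∧ x ∈ (C.set i.castSucc).1 :=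
    Finset.mem_inter
  have h₂ : x ∈ (X ⊓ C.set i.succ).1 ↔ x ∈ X.1 ∧ x ∈ (C.set i.succ).1 := Finset.mem_inter
  have h₃ : x ∈ (C.set i.castSucc).1 → x ∈ (C.set i.succ).1 := fun h =>
    C.subset_of_le (Fin.castSucc_le_succ i) h
  rw [← Bool.decide_and, decide_eq_decide, h₁, h₂]
  tauto

theorem length_le (C : Chain Q k) : k ≤ n := by
  have h : ∀ i : Fin (k + 1), (i : ℕ) ≤ (C.set i).1.card := by
    intro i
    induction i using Fin.induction with
    | zero => simp
    | succ i ih =>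
      have := Finset.card_lt_card (show (C.set i.castSucc).1 ⊂ (C.set i.succ).1 from
        C.strictMono (Fin.castSucc_lt_succ))
      simp only [Fin.val_succ, Fin.val_castSucc] at *
      omega
  have h₁ := h (Fin.last k)
  have h₂ := Finset.card_le_univ (C.set (Fin.last k)).1
  rw [Fintype.card_fin] at h₂
  simp only [Fin.val_last] at h₁
  omega

theorem mem_covering {i : Fin k} {j : Fin m} :
    j ∈ C.covering i ↔ C.Covers (Q.input j) i := by
  simp [covering, edge]

theorem covering_length_le (i : Fin k) : (C.covering i).length ≤ m := by
  simpa [covering] using List.length_filter_le (fun j => decide (i ∈ C.edge j)) (List.finRange m)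

/-- In a good chain `C_i` is generated by `C_{i-1}` and `R_j ∧ C_i`. -/
theorem IsGood.closure_eq {C : Chain Q k} (hC : C.IsGood) {i : Fin k} {j : Fin m}
    (hj : j ∈ C.covering i) :
    Q.closure ((C.set i.castSucc).1 ∪ (Q.input j ⊓ C.set i.succ).1) = (C.set i.succ).1 :=
  congrArg Subtype.val (hC j i (by simpa [edge] using C.mem_covering.1 hj))

end Chain

/-! ### Extension of a tuple to the next element of the chain -/

theorem filterMap_range'_getElem? {α β : Type} (g : α → Option β) (l : List α) (lo len : ℕ) :
    ((List.range' lo len).filterMap fun q => l[q]?.bind g) =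
      ((l.drop lo).take len).filterMap g := by
  induction len generalizing lo with
  | zero => simp
  | succ len ih =>
    rw [List.range'_succ, List.filterMap_cons, ih]
    by_cases h : lo < l.length
    · rw [List.drop_eq_getElem_cons h, List.take_succ_cons, List.filterMap_cons,
        List.getElem?_eq_getElem h]
      rfl
    · rw [List.drop_of_length_le (by omega), List.drop_of_length_le (by omega),
        List.getElem?_eq_none (by omega)]
      simp

section Extend

variable {n m r k : ℕ} {Q : Query n m r} {Dom : Fin n → Type} [∀ x, LinearOrder (Dom x)]
variable (D : Database Q Dom) (C : Chain Q k)

/-- The index of the projection of the expanded `j`-th relation on `R_j ∧ C_i`. -/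
def projIndex (j : Fin m) (i : Fin k) : Array (Tuple Dom) :=
  (projectionIndexT (Q.input j ⊓ C.set i.succ).1 (C.attrs (Q.input j ⊓ C.set i.succ))
    (expanded D j)).val

/-- The range of the tuples of `Π_{R_j ∧ C_i}(R_j)` that agree with `t` on `R_j ∧ C_{i-1}`. -/
def candidateRange (i : Fin k) (t : Tuple Dom) (j : Fin m) : ℕ × ℕ :=
  (rangeT (projIndex D C j i) (C.attrs (Q.input j ⊓ C.set i.castSucc)) t).val

/-- The tuples of `Π_{R_j ∧ C_i}(R_j)` that agree with `t` on `R_j ∧ C_{i-1}`. -/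
def candidates (i : Fin k) (t : Tuple Dom) (j : Fin m) : List (Tuple Dom) :=
  ((projIndex D C j i).toList.drop (candidateRange D C i t j).1).take
    ((candidateRange D C i t j).2 - (candidateRange D C i t j).1)

/-- The number of tuples of the expanded `j`-th relation that agree with `t` on `X`. -/
def degree (X : Finset (Fin n)) (t : Tuple Dom) (j : Fin m) : ℕ :=
  (expanded D j).countP fun s => ∀ x ∈ X, s x = t x

variable {D C}

theorem mem_projIndex {j : Fin m} {i : Fin k} {s : Tuple Dom} :
    s ∈ (projIndex D C j i).toList ↔
      ∃ s' ∈ expanded D j, restrict (Q.input j ⊓ C.set i.succ).1 s' = s :=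
  mem_projectionIndexT _ fun _ hx => C.mem_attrs.2 hx

theorem mem_candidates {i : Fin k} {t : Tuple Dom} {j : Fin m} {s : Tuple Dom} :
    s ∈ candidates D C i t j ↔
      (∃ s' ∈ expanded D j, restrict (Q.input j ⊓ C.set i.succ).1 s' = s) ∧
        ∀ x ∈ (Q.input j ⊓ C.set i.castSucc).1, s x = t x := by
  obtain ⟨B, hB⟩ := C.exists_attrs_eq_append (Q.input j) i
  have hsort : (projIndex D C j i).toList.Pairwise
      (LexLE (C.attrs (Q.input j ⊓ C.set i.castSucc) ++ B)) := by
    rw [← hB]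
    exact projectionIndexT_sorted _ _ _
  have hmem : ∀ q : ℕ, (projIndex D C j i)[q]? = some s →
      ((candidateRange D C i t j).1 ≤ q ∧ q < (candidateRange D C i t j).2 ↔
        ∀ x ∈ (Q.input j ⊓ C.set i.castSucc).1, s x = t x) := fun q hq => by
    rw [candidateRange, mem_rangeT _ _ B t hsort hq]
    exact forall_congr' fun x => by rw [C.mem_attrs]
  rw [← mem_projIndex, candidates, List.mem_iff_getElem?, List.mem_iff_getElem?]
  constructor
  · rintro ⟨q, hq⟩
    rw [List.getElem?_take] at hq
    split_ifs at hq with hlt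
    rw [List.getElem?_drop] at hq
    refine ⟨⟨_, hq⟩, (hmem _ (by rwa [← Array.getElem?_toList])).1 ⟨by omega, by omega⟩⟩
  · rintro ⟨⟨q, hq⟩, h⟩
    have hr := (hmem q (by rwa [← Array.getElem?_toList])).2 h
    refine ⟨q - (candidateRange D C i t j).1, ?_⟩
    rw [List.getElem?_take, if_pos (by omega), List.getElem?_drop,
      Nat.add_sub_cancel' hr.1, hq]

theorem candidates_nodup (i : Fin k) (t : Tuple Dom) (j : Fin m) :
    (candidates D C i t j).Nodup :=
  ((projectionIndexT_nodup _ fun _ hx => C.mem_attrs.2 hx).sublist (List.drop_sublist _ _)).sublist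
    (List.take_sublist _ _)

theorem candidates_length (i : Fin k) (t : Tuple Dom) (j : Fin m) :
    (candidates D C i t j).length =
      (candidateRange D C i t j).2 - (candidateRange D C i t j).1 := by
  obtain ⟨B, hB⟩ := C.exists_attrs_eq_append (Q.input j) i
  have hle : (candidateRange D C i t j).2 ≤ (projIndex D C j i).size :=
    rangeT_snd_le _ _ _ ((projectionIndexT_sorted _ _ _).imp fun h => by
      rw [hB] at h
      exact h.of_append)
  rw [candidates, List.length_take, List.length_drop, Array.length_toList]
  omega

theorem candidates_length_le_degree (i : Fin k) (t : Tuple Dom) (j : Fin m) :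
    (candidates D C i t j).length ≤ degree D (Q.input j ⊓ C.set i.castSucc).1 t j := by
  have hsub : candidates D C i t j ⊆
      ((expanded D j).filter fun s => ∀ x ∈ (Q.input j ⊓ C.set i.castSucc).1, s x = t x).map
        (restrict (Q.input j ⊓ C.set i.succ).1) := by
    intro s hs
    obtain ⟨⟨s', hs', rfl⟩, h⟩ := mem_candidates.1 hs
    refine List.mem_map.2 ⟨s', List.mem_filter.2 ⟨hs', ?_⟩, rfl⟩
    refine decide_eq_true fun x hx => ?_
    rw [← h x hx, restrict_apply_of_mem]
    exact Finset.inter_subset_inter_left (C.subset_of_le (Fin.castSucc_le_succ i)) hx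
  have := ((candidates_nodup i t j).subperm hsub).length_le
  rwa [List.length_map, ← List.countP_eq_length_filter] at this

theorem verifyT_val {i : Fin k} {t u : Tuple Dom} {j : Fin m} :
    (verifyT D C (guardIndex D) (projIndex D C) i t u j).val = true ↔
      (∃ s ∈ expanded D j, ∀ x ∈ (Q.input j ⊓ C.set i.succ).1, s x = u x) ∧
        (expandT D (guardIndex D)
          (joinTuple t (restrict (Q.input j ⊓ C.set i.succ).1 u))).val = some u := by
  have hsort : (projIndex D C j i).toList.Pairwise
      (LexLE (C.attrs (Q.input j ⊓ C.set i.succ) ++ [])) := by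
    rw [List.append_nil]
    exact projectionIndexT_sorted _ _ _
  have hle : (rangeT (projIndex D C j i) (C.attrs (Q.input j ⊓ C.set i.succ)) u).val.2 ≤
      (projIndex D C j i).size :=
    rangeT_snd_le _ _ _ (projectionIndexT_sorted _ _ _)
  have hrange : (rangeT (projIndex D C j i) (C.attrs (Q.input j ⊓ C.set i.succ)) u).val.1 <
      (rangeT (projIndex D C j i) (C.attrs (Q.input j ⊓ C.set i.succ)) u).val.2 ↔
      ∃ s ∈ expanded D j, ∀ x ∈ (Q.input j ⊓ C.set i.succ).1, s x = u x := by
    constructor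
    · intro h
      have hsome := Array.getElem?_eq_getElem (h.trans_le hle)
      have h₁ := (mem_rangeT _ _ [] u hsort hsome).1 ⟨le_rfl, h⟩
      obtain ⟨s, hs, h₂⟩ := mem_projIndex.1 (Array.getElem_mem_toList (h.trans_le hle))
      refine ⟨s, hs, fun x hx => ?_⟩
      rw [← h₁ x (C.mem_attrs.2 hx), ← h₂, restrict_apply_of_mem hx]
    · rintro ⟨s, hs, h⟩
      obtain ⟨q, hq⟩ := List.mem_iff_getElem?.1
        ((mem_projIndex (D := D) (C := C) (i := i)).2 ⟨s, hs, rfl⟩)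
      rw [Array.getElem?_toList] at hq
      have := (mem_rangeT _ _ [] u hsort hq).2 fun x hx => by
        rw [restrict_apply_of_mem (C.mem_attrs.1 hx), h x (C.mem_attrs.1 hx)]
      exact this.1.trans_lt this.2
  rw [← hrange]
  simp only [verifyT, Timed.bind_val]
  split_ifs with hlt
  · simp only [Timed.bind_val, hlt, true_and]
    cases ho : (expandT D (guardIndex D)
        (joinTuple t (restrict (Q.input j ⊓ C.set i.succ).1 u))).val with
    | none => simp
    | some u' =>
      simp only [Option.some.injEq]
      rw [eqT_val]
      exact ⟨fun h => funext fun x => h x (List.mem_finRange x), fun h x _ => by rw [h]⟩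
  · simp [hlt]

/-- The expansion of `t ⋈ s`, if it passes the verification against the relations other than
`j`. -/
def extendBy (D : Database Q Dom) (C : Chain Q k) (i : Fin k) (t : Tuple Dom) (j : Fin m)
    (s : Tuple Dom) : Option (Tuple Dom) :=
  (expandT D (guardIndex D) (joinTuple t s)).val.bind fun u =>
    if ((C.covering i).filter fun j' => j' ≠ j).all fun j' =>
      (verifyT D C (guardIndex D) (projIndex D C) i t u j').val then some u else none

/-- The extensions of `t` come from the candidates of a covering relation that has fewest of them.
The step count is stated for arbitrary bounds `a`, `b`, `c` on the steps of a range search, an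
expansion and a verification. -/
theorem extendT_val (hC : C.AllCovered) (i : Fin k) (t : Tuple Dom) :
    ∃ j ∈ C.covering i,
      (∀ j' ∈ C.covering i,
        (candidates D C i t j).length ≤ (candidates D C i t j').length) ∧
      (extendT D C (guardIndex D) (projIndex D C) i t).val =
        (candidates D C i t j).filterMap (extendBy D C i t j) ∧
      ∀ a b c : ℕ,
        (∀ j' ∈ C.covering i, (rangeT (projIndex D C j' i)
          (C.attrs (Q.input j' ⊓ C.set i.castSucc)) t).steps ≤ a) →
        (∀ s, (expandT D (guardIndex D) s).steps ≤ b) →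
        (∀ u j', (verifyT D C (guardIndex D) (projIndex D C) i t u j').steps ≤ c) →
        (extendT D C (guardIndex D) (projIndex D C) i t).steps ≤
          m * (a + 1) + m +
            (candidates D C i t j).length * (1 + (n + (b + (m + m * (c + 1)))) + 1) := by
  set ranges := (C.covering i).map fun j => (j, candidateRange D C i t j) with hranges
  have hmap : (mapT (fun j => do
      let p ← rangeT (projIndex D C j i) (C.attrs (Q.input j ⊓ C.set i.castSucc)) t
      pure (j, p)) (C.covering i)).val = ranges := mapT_val _ _
  cases hbest : (argminT (fun q : Fin m × ℕ × ℕ => q.2.2 - q.2.1) ranges).val with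
  | none =>
    have := argminT_val_eq_none _ hbest
    obtain ⟨j, hj⟩ := hC i
    have hj' : j ∈ C.covering i := by simpa [Chain.covering] using hj
    rw [hranges, List.map_eq_nil_iff] at this
    rw [this] at hj'
    simp at hj'
  | some q =>
    obtain ⟨hq, hmin⟩ := argminT_val_eq_some _ hbest
    obtain ⟨j, hj, rfl⟩ := List.mem_map.1 hq
    refine ⟨j, hj, fun j' hj' => ?_, ?_, fun a b c ha hb hc => ?_⟩
    · rw [candidates_length, candidates_length]
      exact hmin _ (List.mem_map.2 ⟨j', hj', rfl⟩)
    · unfold extendT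
      rw [Timed.bind_val, Timed.bind_val, hmap, hbest, candidates, ← filterMap_range'_getElem?]
      simp only
      rw [filterMapT_val]
      refine List.filterMap_congr fun q _ => ?_
      simp only [Timed.bind_val, Array.getElem?_toList]
      cases (projIndex D C j i)[q]? with
      | none => rfl
      | some s =>
        simp only [Timed.bind_val, Option.bind_some, extendBy]
        cases (expandT D (guardIndex D) (joinTuple t s)).val with
        | none => rfl
        | some u =>
          simp only [Timed.bind_val, Timed.pure_val, allT_val, Option.bind_some]
    · unfold extendT
      rw [Timed.bind_steps, Timed.bind_steps, hmap, hbest]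
      simp only
      have h₁ := mapT_steps_le (c := a) (fun j => do
        let p ← rangeT (projIndex D C j i) (C.attrs (Q.input j ⊓ C.set i.castSucc)) t
        pure (j, p)) (C.covering i) fun j' hj' => by
          simpa only [Timed.bind_steps, Timed.pure_steps, add_zero] using ha j' hj'
      have h₂ : ranges.length ≤ m := by
        rw [hranges, List.length_map]
        exact C.covering_length_le i
      rw [argminT_steps]
      have h₃ := Nat.mul_le_mul_right (a + 1) (C.covering_length_le i)
      rw [add_assoc]
      refine add_le_add (h₁.trans h₃) (add_le_add h₂ ?_)
      rw [candidates_length]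
      refine (filterMapT_steps_le (c := 1 + (n + (b + (m + m * (c + 1))))) _ _
        fun q _ => ?_).trans ?_
      · rw [Timed.bind_steps, tick_steps]
        cases (projIndex D C j i)[q]? with
        | none => simp
        | some s =>
          simp only
          rw [Timed.bind_steps, tick_steps, Timed.bind_steps]
          refine Nat.add_le_add_left (Nat.add_le_add_left (add_le_add (hb _) ?_) _) _
          cases (expandT D (guardIndex D) (joinTuple t s)).val with
          | none => simp
          | some u =>
            simp only
            rw [Timed.bind_steps, tick_steps, Timed.bind_steps, Timed.pure_steps]
            refine Nat.add_le_add_left ?_ _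
            refine (allT_steps_le _ (c := c) _ fun j' _ => hc u j').trans ?_
            refine Nat.mul_le_mul_right _ ((List.length_filter_le _ _).trans ?_)
            exact C.covering_length_le i
      · rw [List.length_range']

end Extend

/-! ### Correctness of the levels -/

section Levels

variable {n m r k : ℕ} {Q : Query n m r} {Dom : Fin n → Type} [∀ x, LinearOrder (Dom x)]
variable (D : Database Q Dom) (C : Chain Q k)

/-- A tuple over `C_i` that satisfies the dependencies and whose projections on `R_j ∧ C_i` lie in
those of the expanded relations.  Nothing is asked for `j` while `R_j ∧ C_i = ∅`: such a relation
has not been inspected yet, and its expansion may turn out to be empty. -/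
structure IsPartialAnswer (i : Fin (k + 1)) (t : Tuple Dom) : Prop where
  support_eq : support t = (C.set i).1
  consistent : Consistent D (guardIndex D) t
  agrees : ∀ j, (Q.input j ⊓ C.set i).1 = ∅ ∨
    ∃ s ∈ expanded D j, ∀ x ∈ (Q.input j ⊓ C.set i).1, s x = t x

/-- What is maintained about `Q_i`: it has no repetitions, its elements are partial answers, and
every answer passes through it. -/
structure IsLevel (i : Fin (k + 1)) (q : List (Tuple Dom)) : Prop where
  nodup : q.Nodup
  sound : ∀ t ∈ q, IsPartialAnswer D C i t
  complete : ∀ a ∈ D.answer, restrict (C.set i).1 (ofTotal a) ∈ q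

variable {D C}

theorem Chain.inter_eq_of_not_mem_covering {i : Fin k} {j : Fin m} (hj : j ∉ C.covering i) :
    Q.input j ⊓ C.set i.succ = Q.input j ⊓ C.set i.castSucc := by
  rw [C.mem_covering] at hj
  exact not_not.1 hj

theorem IsPartialAnswer.exists_agrees {i : Fin k} {u : Tuple Dom}
    (hu : IsPartialAnswer D C i.succ u) {j : Fin m} (hj : j ∈ C.covering i) :
    ∃ s ∈ expanded D j, ∀ x ∈ (Q.input j ⊓ C.set i.succ).1, s x = u x := by
  refine (hu.agrees j).resolve_left fun h => C.mem_covering.1 hj (Subtype.ext ?_)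
  refine h.trans (Finset.subset_empty.1 ?_).symm
  rw [← h]
  exact Finset.inter_subset_inter_left (C.subset_of_le (Fin.castSucc_le_succ i))

theorem support_of_mem_candidates {i : Fin k} {t : Tuple Dom} {j : Fin m} {s : Tuple Dom}
    (hs : s ∈ candidates D C i t j) : support s = (Q.input j ⊓ C.set i.succ).1 := by
  obtain ⟨⟨s', hs', rfl⟩, -⟩ := mem_candidates.1 hs
  refine support_restrict ?_
  rw [support_of_mem_expanded hs']
  exact Finset.inter_subset_left

theorem extendBy_eq_some (hC : C.IsGood) {i : Fin k} {t : Tuple Dom}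
    (ht : IsPartialAnswer D C i.castSucc t) {j : Fin m} (hj : j ∈ C.covering i) {s u : Tuple Dom}
    (hs : s ∈ candidates D C i t j) (hu : extendBy D C i t j s = some u) :
    Extends t u ∧ IsPartialAnswer D C i.succ u ∧
      restrict (Q.input j ⊓ C.set i.succ).1 u = s := by
  obtain ⟨u', hu', hver⟩ := Option.bind_eq_some_iff.1 hu
  split_ifs at hver with hall
  obtain rfl := Option.some.inj hver
  obtain ⟨hext, hsupp, hcons⟩ := expandT_eq_some hu'
  have hss := support_of_mem_candidates hs
  rw [support_joinTuple, ht.support_eq, hss, hC.closure_eq hj] at hsupp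
  have htu : Extends t u' := (extends_joinTuple t s).trans hext
  obtain ⟨⟨s', hs', hs's⟩, hst⟩ := mem_candidates.1 hs
  have hus : ∀ x ∈ (Q.input j ⊓ C.set i.succ).1, u' x = s x := by
    intro x hx
    by_cases hxt : t x = ⊥
    · have hsx : s x ≠ ⊥ := mem_support.1 (hss ▸ hx)
      have hjx : joinTuple t s x = s x := by simp [joinTuple, hxt]
      rw [hext x (by rwa [hjx]), hjx]
    · rw [htu x hxt, hst x]
      refine Finset.mem_inter.2 ⟨(Finset.mem_inter.1 hx).1, ?_⟩
      rw [← ht.support_eq]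
      exact mem_support.2 hxt
  refine ⟨htu, ⟨hsupp, hcons, fun j' => ?_⟩, ?_⟩
  · by_cases hj' : j' ∈ C.covering i
    · right
      by_cases hjj : j' = j
      · subst hjj
        refine ⟨s', hs', fun x hx => ?_⟩
        rw [hus x hx, ← hs's, restrict_apply_of_mem hx]
      · exact (verifyT_val.1 (List.all_eq_true.1 hall j' (by simp [hj', hjj]))).1
    · rw [Chain.inter_eq_of_not_mem_covering hj']
      refine (ht.agrees j').imp_right fun ⟨s₁, hs₁, h⟩ => ⟨s₁, hs₁, fun x hx => ?_⟩
      rw [h x hx, htu x]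
      rw [← mem_support, ht.support_eq]
      exact (Finset.mem_inter.1 hx).2
  · funext x
    by_cases hx : x ∈ (Q.input j ⊓ C.set i.succ).1
    · rw [restrict_apply_of_mem hx, hus x hx]
    · have : s x = ⊥ := by
        rw [← hss, mem_support] at hx
        exact not_not.1 hx
      simp [restrict, hx, this]

theorem extendBy_of_mem_answer (hC : C.IsGood) {i : Fin k} {j : Fin m} (hj : j ∈ C.covering i)
    {a : (x : Fin n) → Dom x} (ha : a ∈ D.answer) :
    extendBy D C i (restrict (C.set i.castSucc).1 (ofTotal a)) j
        (restrict (Q.input j ⊓ C.set i.succ).1 (ofTotal a)) =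
      some (restrict (C.set i.succ).1 (ofTotal a)) := by
  have hcons := consistent_of_mem_answer ha
  have hsupp : ∀ X : Finset (Fin n), support (restrict X (ofTotal a)) = X := fun X =>
    support_restrict (by rw [support_ofTotal]; exact Finset.subset_univ X)
  have hexp : ∀ j' ∈ C.covering i, (expandT D (guardIndex D)
      (joinTuple (restrict (C.set i.castSucc).1 (ofTotal a))
        (restrict (Q.input j' ⊓ C.set i.succ).1 (ofTotal a)))).val =
      some (restrict (C.set i.succ).1 (ofTotal a)) := fun j' hj' => by
    rw [expandT_of_extends (joinTuple_extends (restrict_extends _ _) (restrict_extends _ _)) hcons,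
      support_joinTuple, hsupp, hsupp, hC.closure_eq hj']
  rw [extendBy, hexp j hj, Option.bind_some, if_pos]
  refine List.all_eq_true.2 fun j' hj' => verifyT_val.2 ⟨?_, ?_⟩
  · refine ⟨_, restrict_mem_expanded ha j', fun x hx => ?_⟩
    rw [restrict_apply_of_mem (Finset.mem_inter.1 hx).1,
      restrict_apply_of_mem (Finset.mem_inter.1 hx).2]
  · have : restrict (Q.input j' ⊓ C.set i.succ).1 (restrict (C.set i.succ).1 (ofTotal a)) =
        restrict (Q.input j' ⊓ C.set i.succ).1 (ofTotal a) :=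
      restrict_eq_iff.2 fun x hx => restrict_apply_of_mem (Finset.mem_inter.1 hx).2
    rw [this]
    exact hexp j' (List.mem_filter.1 hj').1

theorem extendT_nodup (hC : C.IsGood) (hcov : C.AllCovered) {i : Fin k} {t : Tuple Dom}
    (ht : IsPartialAnswer D C i.castSucc t) :
    (extendT D C (guardIndex D) (projIndex D C) i t).val.Nodup := by
  obtain ⟨j, hj, -, hval, -⟩ := extendT_val (D := D) hcov i t
  rw [hval]
  refine List.pairwise_filterMap.2 ((candidates_nodup i t j).imp_of_mem
    fun {s s'} hs hs' hne u hu u' hu' => ?_)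
  rintro rfl
  rw [← (extendBy_eq_some hC ht hj hs hu).2.2, ← (extendBy_eq_some hC ht hj hs' hu').2.2] at hne
  exact hne rfl

theorem of_mem_extendT (hC : C.IsGood) (hcov : C.AllCovered) {i : Fin k} {t : Tuple Dom}
    (ht : IsPartialAnswer D C i.castSucc t) {u : Tuple Dom}
    (hu : u ∈ (extendT D C (guardIndex D) (projIndex D C) i t).val) :
    Extends t u ∧ IsPartialAnswer D C i.succ u := by
  obtain ⟨j, hj, -, hval, -⟩ := extendT_val (D := D) hcov i t
  rw [hval] at hu
  obtain ⟨s, hs, hsu⟩ := List.mem_filterMap.1 hu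
  exact ⟨(extendBy_eq_some hC ht hj hs hsu).1, (extendBy_eq_some hC ht hj hs hsu).2.1⟩

theorem mem_extendT_of_mem_answer (hC : C.IsGood) (hcov : C.AllCovered) (i : Fin k)
    {a : (x : Fin n) → Dom x} (ha : a ∈ D.answer) :
    restrict (C.set i.succ).1 (ofTotal a) ∈ (extendT D C (guardIndex D) (projIndex D C) i
      (restrict (C.set i.castSucc).1 (ofTotal a))).val := by
  obtain ⟨j, hj, -, hval, -⟩ :=
    extendT_val (D := D) hcov i (restrict (C.set i.castSucc).1 (ofTotal a))
  rw [hval]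
  refine List.mem_filterMap.2 ⟨_, mem_candidates.2 ⟨⟨_, restrict_mem_expanded ha j, ?_⟩, ?_⟩,
    extendBy_of_mem_answer hC hj ha⟩
  · exact restrict_eq_iff.2 fun x hx => restrict_apply_of_mem (Finset.mem_inter.1 hx).1
  · intro x hx
    rw [restrict_apply_of_mem (Finset.mem_inter.1 hx).2, restrict_apply_of_mem]
    exact Finset.inter_subset_inter_left (C.subset_of_le (Fin.castSucc_le_succ i)) hx

theorem IsLevel.step (hC : C.IsGood) (hcov : C.AllCovered) {i : Fin k} {q : List (Tuple Dom)}
    (hq : IsLevel D C i.castSucc q) :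
    IsLevel D C i.succ
      (flatMapT (extendT D C (guardIndex D) (projIndex D C) i) q).val := by
  rw [flatMapT_val]
  refine ⟨List.nodup_flatMap.2 ⟨fun t ht => extendT_nodup hC hcov (hq.sound t ht), ?_⟩,
    fun u hu => ?_, fun a ha => ?_⟩
  · refine hq.nodup.imp_of_mem fun {t t'} ht ht' hne => List.disjoint_left.2 fun u hu hu' => hne ?_
    have h₁ := (of_mem_extendT hC hcov (hq.sound t ht) hu).1.eq_restrict
    have h₂ := (of_mem_extendT hC hcov (hq.sound t' ht') hu').1.eq_restrict
    rw [h₁, h₂, (hq.sound t ht).support_eq, (hq.sound t' ht').support_eq]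
  · obtain ⟨t, ht, htu⟩ := List.mem_flatMap.1 hu
    exact (of_mem_extendT hC hcov (hq.sound t ht) htu).2
  · exact List.mem_flatMap.2 ⟨_, hq.complete a ha, mem_extendT_of_mem_answer hC hcov i ha⟩

variable (D C)

theorem isLevel_zero : IsLevel D C 0 [fun _ => ⊥] := by
  have h₀ : (C.set 0).1 = ∅ := congrArg Subtype.val C.set_zero
  have hs : support (fun _ => ⊥ : Tuple Dom) = ∅ := by ext x; simp
  refine ⟨List.nodup_singleton _, fun t ht => ?_, fun a _ => ?_⟩
  · rw [List.mem_singleton] at ht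
    subst ht
    refine ⟨hs.trans h₀.symm, fun f hf => ?_, fun j => Or.inl ?_⟩
    · rw [hs] at hf
      exact absurd (Finset.subset_empty.1 hf) (Q.lhs_nonempty f).ne_empty
    · exact Finset.subset_empty.1 (h₀ ▸ Finset.inter_subset_right)
  · rw [List.mem_singleton, h₀]
    funext x
    simp [restrict]

variable {D C}

/-- On the last level the partial answers are the answers. -/
theorem IsLevel.eq_answer (hne : ∀ j, D.rel j ≠ []) {q : List (Tuple Dom)}
    (hq : IsLevel D C (Fin.last k) q) : {t | t ∈ q} = ofTotal '' D.answer := by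
  have hl : (C.set (Fin.last k)).1 = Finset.univ := congrArg Subtype.val C.set_last
  refine Set.Subset.antisymm (fun t ht => ?_) ?_
  · obtain ⟨hsupp, hcons, hagr⟩ := hq.sound t ht
    rw [hl] at hsupp
    have hb : ∀ x, t x ≠ ⊥ := fun x => mem_support.1 (hsupp ▸ Finset.mem_univ x)
    obtain ⟨a, rfl⟩ : ∃ a, ofTotal a = t :=
      ⟨fun x => (t x).unbot (hb x), funext fun x => WithBot.coe_unbot _ _⟩
    refine ⟨a, ⟨fun j => ?_, fun f hf => ?_⟩, rfl⟩
    · have hin : (Q.input j ⊓ C.set (Fin.last k)).1 = (Q.input j).1 := by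
        rw [C.set_last, inf_top_eq]
      have hv : Q.vars j ⊆ (Q.input j).1 := Q.subset_closure _
      rw [← hin] at hv
      rcases hagr j with h | ⟨s, hs, h⟩
      -- A relation without attributes consists of the empty tuple only.
      · rw [h] at hv
        obtain ⟨s, hs⟩ := List.exists_mem_of_ne_nil _ (hne j)
        have hs' := (Extends.refl s).eq_restrict
        rw [support_of_mem_rel hs] at hs'
        rw [hs'] at hs
        rwa [restrict_eq_iff.2]
        exact fun x hx => absurd (hv hx) (Finset.notMem_empty x)
      · rw [← restrict_eq_iff.2 fun x hx => h x (hv hx)]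
        exact restrict_mem_rel_of_mem_expanded hs
    · exact (satisfies_udf_iff hf _ _).1 (hcons f (by rw [hsupp]; exact Finset.subset_univ _))
  · rintro _ ⟨a, ha, rfl⟩
    have := hq.complete a ha
    rwa [hl, ← support_ofTotal a, ← (Extends.refl (ofTotal a)).eq_restrict] at this

end Levels

/-! ### The size of the levels -/

section Holder

/-- Hölder's inequality for exponents whose sum is at least one. -/
theorem sum_prod_rpow_le_prod_rpow {ι κ : Type*} [Fintype ι] (s : Finset κ) (w A : κ → ℝ)
    (f : ι → κ → ℝ) (hw : ∀ j ∈ s, 0 ≤ w j) (hw₁ : 1 ≤ ∑ j ∈ s, w j) (hA : ∀ j ∈ s, 0 < A j)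
    (hf : ∀ i, ∀ j ∈ s, 0 ≤ f i j) (hfA : ∀ j ∈ s, ∑ i, f i j ≤ A j) :
    ∑ i, ∏ j ∈ s, f i j ^ w j ≤ ∏ j ∈ s, A j ^ w j := by
  set W := ∑ j ∈ s, w j with hW
  have hW₀ : 0 < W := one_pos.trans_le hw₁
  have hle : ∀ i, ∀ j ∈ s, f i j / A j ≤ 1 := fun i j hj => by
    rw [div_le_one (hA j hj)]
    exact (Finset.single_le_sum (f := fun i => f i j) (fun i _ => hf i j hj)
      (Finset.mem_univ i)).trans (hfA j hj)
  -- After normalization each factor increases when the exponents are scaled down to sum one,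
  -- and then the inequality of the weighted means applies.
  have hterm : ∀ i, ∏ j ∈ s, f i j ^ w j ≤
      (∏ j ∈ s, A j ^ w j) * ∑ j ∈ s, w j / W * (f i j / A j) := fun i => by
    have h₁ : ∏ j ∈ s, f i j ^ w j =
        (∏ j ∈ s, A j ^ w j) * ∏ j ∈ s, (f i j / A j) ^ w j := by
      rw [← Finset.prod_mul_distrib]
      refine Finset.prod_congr rfl fun j hj => ?_
      rw [← Real.mul_rpow (hA j hj).le (div_nonneg (hf i j hj) (hA j hj).le),
        mul_div_cancel₀ _ (hA j hj).ne']
    rw [h₁]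
    refine mul_le_mul_of_nonneg_left ?_
      (Finset.prod_nonneg fun j hj => Real.rpow_nonneg (hA j hj).le _)
    have h₂ : ∏ j ∈ s, (f i j / A j) ^ w j ≤ ∏ j ∈ s, (f i j / A j) ^ (w j / W) := by
      refine Finset.prod_le_prod (fun j hj => Real.rpow_nonneg
        (div_nonneg (hf i j hj) (hA j hj).le) _) fun j hj => ?_
      exact Real.rpow_le_rpow_of_exponent_ge' (div_nonneg (hf i j hj) (hA j hj).le) (hle i j hj)
        (div_nonneg (hw j hj) hW₀.le) (div_le_self (hw j hj) hw₁)
    refine h₂.trans (Real.geom_mean_le_arith_mean_weighted s _ _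
      (fun j hj => div_nonneg (hw j hj) hW₀.le) ?_
      fun j hj => div_nonneg (hf i j hj) (hA j hj).le)
    rw [← Finset.sum_div, ← hW, div_self hW₀.ne']
  calc ∑ i, ∏ j ∈ s, f i j ^ w j
      ≤ ∑ i, (∏ j ∈ s, A j ^ w j) * ∑ j ∈ s, w j / W * (f i j / A j) :=
        Finset.sum_le_sum fun i _ => hterm i
    _ = (∏ j ∈ s, A j ^ w j) * ∑ j ∈ s, w j / W * ((∑ i, f i j) / A j) := by
        rw [← Finset.mul_sum, Finset.sum_comm]
        congr 1
        refine Finset.sum_congr rfl fun j _ => ?_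
        rw [← Finset.mul_sum, Finset.sum_div]
    _ ≤ (∏ j ∈ s, A j ^ w j) * 1 := by
        refine mul_le_mul_of_nonneg_left ?_
          (Finset.prod_nonneg fun j hj => Real.rpow_nonneg (hA j hj).le _)
        calc ∑ j ∈ s, w j / W * ((∑ i, f i j) / A j) ≤ ∑ j ∈ s, w j / W * 1 := by
              refine Finset.sum_le_sum fun j hj => mul_le_mul_of_nonneg_left ?_
                (div_nonneg (hw j hj) hW₀.le)
              rw [div_le_one (hA j hj)]
              exact hfA j hj
          _ = 1 := by
              rw [← Finset.sum_mul, mul_one, ← Finset.sum_div, ← hW, div_self hW₀.ne']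
    _ = ∏ j ∈ s, A j ^ w j := mul_one _

/-- If every element of `l` is counted for at most one `u`, the counts add up to at most the
number of elements counted for some `u`. -/
theorem sum_countP_le {α β : Type*} (U : List α) (l : List β) (P : α → β → Prop)
    (P₀ : β → Prop) [∀ u, DecidablePred (P u)] [DecidablePred P₀]
    (h₀ : ∀ u ∈ U, ∀ s ∈ l, P u s → P₀ s)
    (h₁ : ∀ s ∈ l, U.Pairwise fun u u' => ¬ (P u s ∧ P u' s)) :
    (U.map fun u => l.countP fun s => P u s).sum ≤ l.countP fun s => P₀ s := by
  induction U generalizing P₀ with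
  | nil => simp
  | cons u U ih =>
    have h₂ : ∀ s ∈ l, ∀ u' ∈ U, P u s → ¬ P u' s := fun s hs u' hu' h h' =>
      (List.pairwise_cons.1 (h₁ s hs)).1 u' hu' ⟨h, h'⟩
    have h₃ := ih (fun s => P₀ s ∧ ¬ P u s)
      (fun u' hu' s hs h => ⟨h₀ u' (by simp [hu']) s hs h, fun h' => h₂ s hs u' hu' h' h⟩)
      (fun s hs => (List.pairwise_cons.1 (h₁ s hs)).2)
    rw [List.map_cons, List.sum_cons]
    refine (Nat.add_le_add_left h₃ _).trans ?_
    have h₄ : ∀ s ∈ l, P u s → P₀ s := fun s hs h => h₀ u (by simp) s hs h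
    clear h₀ h₁ h₂ h₃ ih
    induction l with
    | nil => simp
    | cons s l ihl =>
      have := ihl fun s hs => h₄ s (by simp [hs])
      simp only [List.countP_cons, decide_eq_true_eq]
      have := h₄ s (by simp)
      split_ifs <;> first | omega | tauto

end Holder

section Weight

variable {n m r k : ℕ} {Q : Query n m r} {Dom : Fin n → Type} [∀ x, LinearOrder (Dom x)]
variable (D : Database Q Dom) (C : Chain Q k) (w : Fin m → ℝ)

/-- The bound `∏_j N_j(t)^{w_j}` for the number of extensions of the tuple `t` over `C_i`, where
`N_j(t)` is the number of tuples of the expanded `j`-th relation that agree with `t`, or one if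
there are none. -/
noncomputable def weight (i : Fin (k + 1)) (t : Tuple Dom) : ℝ :=
  ∏ j, ((max 1 (degree D (Q.input j ⊓ C.set i).1 t j) : ℕ) : ℝ) ^ w j

variable {D C w}

theorem one_le_max_degree_rpow (hw : ∀ j, 0 ≤ w j) (X : Finset (Fin n)) (t : Tuple Dom)
    (j : Fin m) : 1 ≤ ((max 1 (degree D X t j) : ℕ) : ℝ) ^ w j :=
  Real.one_le_rpow (by exact_mod_cast le_max_left _ _) (hw j)

theorem one_le_weight (hw : ∀ j, 0 ≤ w j) (i : Fin (k + 1)) (t : Tuple Dom) :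
    1 ≤ weight D C w i t :=
  Finset.one_le_prod fun j _ => one_le_max_degree_rpow hw _ t j

/-- The non-emptiness of the relations is used here: an empty relation has cardinality zero, but
contributes a factor one to the weight. -/
theorem weight_zero_le (hne : ∀ j, D.rel j ≠ []) (hw : ∀ j, 0 ≤ w j) (t : Tuple Dom) :
    weight D C w 0 t ≤ ∏ j, (D.card j : ℝ) ^ w j := by
  refine Finset.prod_le_prod (fun j _ => Real.rpow_nonneg (Nat.cast_nonneg _) _) fun j _ => ?_
  refine Real.rpow_le_rpow (Nat.cast_nonneg _) (Nat.cast_le.2 (max_le ?_ ?_)) (hw j)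
  · exact List.length_pos_iff.2 (hne j)
  · exact List.countP_le_length.trans (expanded_length_le D j)

theorem Chain.mem_edge_iff {i : Fin k} {j : Fin m} : i ∈ C.edge j ↔ j ∈ C.covering i := by
  simp [Chain.covering]

/-- A bound for the degrees of a tuple in the relations that cover a node is bounded by the weight
of the tuple, since the weights of these relations add up to at least one. -/
theorem le_weight (hw : C.IsFractionalEdgeCover w) {i : Fin k} {t : Tuple Dom} {d : ℕ}
    (hd : ∀ j ∈ C.covering i, d ≤ degree D (Q.input j ⊓ C.set i.castSucc).1 t j) :
    (d : ℝ) ≤ weight D C w i.castSucc t := by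
  rcases Nat.eq_zero_or_pos d with rfl | hpos
  · exact Nat.cast_zero.trans_le (zero_le_one.trans (one_le_weight hw.1 _ _))
  have hd₁ : (1 : ℝ) ≤ d := by exact_mod_cast hpos
  calc (d : ℝ) = (d : ℝ) ^ (1 : ℝ) := (Real.rpow_one _).symm
    _ ≤ (d : ℝ) ^ (∑ j with i ∈ C.edge j, w j) := Real.rpow_le_rpow_of_exponent_le hd₁ (hw.2 i)
    _ = ∏ j with i ∈ C.edge j, (d : ℝ) ^ w j := Real.rpow_sum_of_pos (by positivity) _ _
    _ ≤ ∏ j with i ∈ C.edge j,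
        ((max 1 (degree D (Q.input j ⊓ C.set i.castSucc).1 t j) : ℕ) : ℝ) ^ w j := by
      refine Finset.prod_le_prod (fun j _ => by positivity) fun j hj => ?_
      refine Real.rpow_le_rpow (by positivity) (Nat.cast_le.2 ?_) (hw.1 j)
      exact (hd j (Chain.mem_edge_iff.1 (Finset.mem_filter.1 hj).2)).trans (le_max_right _ _)
    _ ≤ weight D C w i.castSucc t := by
      rw [weight, ← Finset.prod_filter_mul_prod_filter_not Finset.univ (fun j => i ∈ C.edge j)]
      exact le_mul_of_one_le_right (Finset.prod_nonneg fun j _ => by positivity)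
        (Finset.one_le_prod fun j _ => one_le_max_degree_rpow hw.1 _ t j)

/-- The extensions of `t` are determined by their projections on `R_j ∧ C_i`, so their degrees in
the `j`-th relation add up to at most that of `t`. -/
theorem sum_degree_extendT_le (hC : C.IsGood) (hcov : C.AllCovered) {i : Fin k} {t : Tuple Dom}
    (ht : IsPartialAnswer D C i.castSucc t) {j : Fin m} (hj : j ∈ C.covering i) :
    ((extendT D C (guardIndex D) (projIndex D C) i t).val.map fun u =>
      degree D (Q.input j ⊓ C.set i.succ).1 u j).sum ≤
        degree D (Q.input j ⊓ C.set i.castSucc).1 t j := by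
  refine sum_countP_le _ _ (fun (u s : Tuple Dom) => ∀ x ∈ (Q.input j ⊓ C.set i.succ).1, s x = u x)
    (fun s : Tuple Dom => ∀ x ∈ (Q.input j ⊓ C.set i.castSucc).1, s x = t x)
    (fun u hu s _ h x hx => ?_) fun s hs => ?_
  · obtain ⟨htu, -⟩ := of_mem_extendT hC hcov ht hu
    have hx' := Finset.mem_inter.1 hx
    rw [h x (Finset.inter_subset_inter_left (C.subset_of_le (Fin.castSucc_le_succ i)) hx), htu x]
    rw [← mem_support, ht.support_eq]
    exact hx'.2
  · refine (extendT_nodup hC hcov ht).imp_of_mem fun {u u'} hu hu' hne hP => hne ?_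
    obtain ⟨htu, hpu⟩ := of_mem_extendT hC hcov ht hu
    obtain ⟨htu', hpu'⟩ := of_mem_extendT hC hcov ht hu'
    have hsub : (Q.input j ⊓ C.set i.succ).1 ⊆ support u :=
      hpu.support_eq ▸ Finset.inter_subset_right
    have hrr : restrict (Q.input j ⊓ C.set i.succ).1 u =
        restrict (Q.input j ⊓ C.set i.succ).1 u' :=
      restrict_eq_iff.2 fun x hx => (hP.1 x hx).symm.trans (hP.2 x hx)
    have hcl : Q.closure (support (joinTuple t (restrict (Q.input j ⊓ C.set i.succ).1 u))) =
        (C.set i.succ).1 := by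
      rw [support_joinTuple, ht.support_eq, support_restrict hsub, hC.closure_eq hj]
    exact eq_of_consistent (t := joinTuple t (restrict (Q.input j ⊓ C.set i.succ).1 u))
      hpu.consistent hpu'.consistent (joinTuple_extends htu (restrict_extends _ _))
      (joinTuple_extends htu' (hrr ▸ restrict_extends _ _))
      (hpu.support_eq.trans hcl.symm) (hpu'.support_eq.trans hcl.symm)

theorem sum_weight_extendT_le (hC : C.IsGood) (hcov : C.AllCovered)
    (hw : C.IsFractionalEdgeCover w) {i : Fin k} {t : Tuple Dom}
    (ht : IsPartialAnswer D C i.castSucc t) :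
    ((extendT D C (guardIndex D) (projIndex D C) i t).val.map (weight D C w i.succ)).sum ≤
      weight D C w i.castSucc t := by
  have hU := fun u => of_mem_extendT (u := u) hC hcov ht
  have hsum := fun j => sum_degree_extendT_le (j := j) hC hcov ht
  generalize (extendT D C (guardIndex D) (projIndex D C) i t).val = U at hU hsum ⊢
  have hmem : ∀ a : Fin U.length, U[a.1] ∈ U := fun a => List.getElem_mem _
  rw [← Fin.sum_univ_fun_getElem U]
  set c : ℝ := ∏ j with i ∉ C.edge j,
    ((max 1 (degree D (Q.input j ⊓ C.set i.castSucc).1 t j) : ℕ) : ℝ) ^ w j with hc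
  have hsplit : ∀ a : Fin U.length, weight D C w i.succ U[a.1] =
      (∏ j with i ∈ C.edge j,
        ((max 1 (degree D (Q.input j ⊓ C.set i.succ).1 U[a.1] j) : ℕ) : ℝ) ^ w j) * c := by
    intro a
    rw [weight, ← Finset.prod_filter_mul_prod_filter_not Finset.univ (fun j => i ∈ C.edge j), hc]
    congr 1
    refine Finset.prod_congr rfl fun j hj => ?_
    have hj' : j ∉ C.covering i := fun h =>
      (Finset.mem_filter.1 hj).2 (Chain.mem_edge_iff.2 h)
    have hdeg : degree D (Q.input j ⊓ C.set i.succ).1 U[a.1] j =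
        degree D (Q.input j ⊓ C.set i.castSucc).1 t j := by
      rw [Chain.inter_eq_of_not_mem_covering hj']
      unfold degree
      refine List.countP_congr fun s _ => ?_
      rw [decide_eq_true_eq, decide_eq_true_eq]
      refine forall₂_congr fun x hx => ?_
      rw [(hU _ (hmem a)).1 x]
      rw [← mem_support, ht.support_eq]
      exact (Finset.mem_inter.1 hx).2
    rw [hdeg]
  rw [Finset.sum_congr rfl fun a _ => hsplit a, ← Finset.sum_mul, weight,
    ← Finset.prod_filter_mul_prod_filter_not Finset.univ (fun j => i ∈ C.edge j)]
  refine mul_le_mul_of_nonneg_right ?_ (Finset.prod_nonneg fun j _ => by positivity)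
  refine sum_prod_rpow_le_prod_rpow {j | i ∈ C.edge j} w
    (fun j => ((max 1 (degree D (Q.input j ⊓ C.set i.castSucc).1 t j) : ℕ) : ℝ))
    (fun (a : Fin U.length) j =>
      ((max 1 (degree D (Q.input j ⊓ C.set i.succ).1 U[a.1] j) : ℕ) : ℝ))
    (fun j _ => hw.1 j) (hw.2 i) (fun j _ => Nat.cast_pos.2 (one_pos.trans_le (le_max_left _ _)))
    (fun _ _ _ => Nat.cast_nonneg _) fun j hj => ?_
  have hj' : j ∈ C.covering i := Chain.mem_edge_iff.1 (Finset.mem_filter.1 hj).2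
  -- The extensions agree with some tuple of the relation, so the maximum is the degree itself.
  have hmax : ∀ a : Fin U.length, max 1 (degree D (Q.input j ⊓ C.set i.succ).1 U[a.1] j) =
      degree D (Q.input j ⊓ C.set i.succ).1 U[a.1] j := fun a => by
    obtain ⟨s, hs, h⟩ := (hU _ (hmem a)).2.exists_agrees hj'
    exact max_eq_right (List.countP_pos_iff.2 ⟨s, hs, decide_eq_true h⟩)
  simp only [hmax]
  rw [← Nat.cast_sum, Nat.cast_le,
    Fin.sum_univ_fun_getElem U fun u => degree D (Q.input j ⊓ C.set i.succ).1 u j]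
  exact (hsum j hj').trans (le_max_right _ _)

theorem sum_weight_flatMapT_le (hC : C.IsGood) (hcov : C.AllCovered)
    (hw : C.IsFractionalEdgeCover w) {i : Fin k} {q : List (Tuple Dom)}
    (hq : ∀ t ∈ q, IsPartialAnswer D C i.castSucc t) :
    ((flatMapT (extendT D C (guardIndex D) (projIndex D C) i) q).val.map
      (weight D C w i.succ)).sum ≤ (q.map (weight D C w i.castSucc)).sum := by
  rw [flatMapT_val]
  induction q with
  | nil => simp
  | cons t q ih =>
    rw [List.flatMap_cons, List.map_append, List.sum_append, List.map_cons, List.sum_cons]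
    exact add_le_add (sum_weight_extendT_le hC hcov hw (hq t (by simp)))
      (ih fun t ht => hq t (by simp [ht]))

end Weight

/-! ### Step counts of the parts of the algorithm -/

section Steps

variable {n m r k : ℕ} {Q : Query n m r} {Dom : Fin n → Type} [∀ x, LinearOrder (Dom x)]
variable {D : Database Q Dom} {C : Chain Q k} {d : ℕ}

theorem lhsAttrs_length_le (f : Fin r) : (lhsAttrs Q f).length ≤ n := by
  simpa [lhsAttrs] using
    List.length_filter_le (fun x => decide (x ∈ Q.lhs f)) (List.finRange n)

theorem Query.one_le_size (Q : Query n m r) : 1 ≤ Q.size := by unfold Query.size; omega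

/-- The exponent `d` bounds the number of halvings of a binary search and the depth of a merge
sort; in the end it is `⌊log₂ N⌋ + 1`. -/
theorem rangeT_steps_le_size (Q : Query n m r) (hd : 1 ≤ d) (a : Array (Tuple Dom))
    {A : List (Fin n)} (hA : A.length ≤ n) (t : Tuple Dom) (ha : a.size < 2 ^ d) :
    (rangeT a A t).steps ≤ 6 * (d * Q.size) := by
  have h₁ := rangeT_steps_le a A t ha
  have h₂ : d * (A.length + 2) ≤ d * (2 * Q.size) := by
    refine Nat.mul_le_mul_left d ?_
    unfold Query.size
    omega
  have h₃ : 1 ≤ d * Q.size := Nat.mul_pos hd Q.one_le_size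
  nlinarith

theorem valueT_steps_le {G : Fin r → Array (Tuple Dom)} (hd : 1 ≤ d)
    (hG : ∀ f, (G f).size < 2 ^ d) (f : Fin r) (t : Tuple Dom) (ht : ∀ x ∈ Q.lhs f, t x ≠ ⊥) :
    (valueT D G f t ht).steps ≤ 6 * (d * Q.size) + n + 2 := by
  cases hf : Q.guard f with
  | none =>
    rw [valueT_of_guard_eq_none D G hf]
    simp only [Timed.bind_steps, tick_steps, Timed.pure_steps]
    omega
  | some j =>
    rw [valueT_of_guard_eq_some D G hf]
    have h := rangeT_steps_le_size Q hd (G f) (lhsAttrs_length_le (Q := Q) f) t (hG f)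
    rw [Timed.bind_steps, Timed.bind_steps, tick_steps]
    split_ifs
    · cases (G f)[(rangeT (G f) (lhsAttrs Q f) t).val.1]? <;> simp only [Timed.pure_steps] <;> omega
    · rw [Timed.pure_steps]
      omega

theorem applyFDT_steps_le {G : Fin r → Array (Tuple Dom)} (hd : 1 ≤ d)
    (hG : ∀ f, (G f).size < 2 ^ d) (f : Fin r) (t : Tuple Dom) :
    (applyFDT D G f t).steps ≤ 13 * (d * Q.size) := by
  have h₁ : n + 1 ≤ d * Q.size := by
    refine le_trans ?_ (Nat.le_mul_of_pos_left _ hd)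
    unfold Query.size
    omega
  unfold applyFDT
  rw [Timed.bind_steps, tick_steps]
  by_cases ht : ∀ x ∈ Q.lhs f, t x ≠ ⊥
  · rw [dif_pos ht, Timed.bind_steps, Timed.bind_steps, tick_steps]
    have h₂ := valueT_steps_le (D := D) hd hG f t ht
    split_ifs
    · rw [Timed.pure_steps]
      omega
    · rw [Timed.bind_steps, tick_steps, Timed.pure_steps]
      omega
    · rw [Timed.pure_steps]
      omega
    · rw [Timed.pure_steps]
      omega
  · rw [dif_neg ht, Timed.pure_steps]
    omega

theorem applyFDsT_steps_le {G : Fin r → Array (Tuple Dom)} (hd : 1 ≤ d)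
    (hG : ∀ f, (G f).size < 2 ^ d) (l : List (Fin r)) (t : Tuple Dom) :
    (applyFDsT D G l t).steps ≤ l.length * (13 * (d * Q.size)) := by
  induction l generalizing t with
  | nil => simp [applyFDsT]
  | cons f l ih =>
    have h := applyFDT_steps_le (D := D) hd hG f t
    simp only [applyFDsT, Timed.bind_steps, List.length_cons]
    rw [add_mul, one_mul, add_comm]
    refine add_le_add ?_ h
    cases (applyFDT D G f t).val with
    | none => simp
    | some t' => exact ih t'

theorem expandT_steps_le {G : Fin r → Array (Tuple Dom)} (hd : 1 ≤ d)
    (hG : ∀ f, (G f).size < 2 ^ d) (t : Tuple Dom) :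
    (expandT D G t).steps ≤ 13 * (d * Q.size ^ 3) := by
  refine (applyFDsT_steps_le hd hG _ t).trans ?_
  have h₁ : ((List.replicate (n + 1) (List.finRange r)).flatten).length = (n + 1) * r := by
    simp
  have h₂ : (n + 1) * r ≤ Q.size * Q.size := by
    refine Nat.mul_le_mul ?_ ?_ <;> unfold Query.size <;> omega
  rw [h₁]
  calc (n + 1) * r * (13 * (d * Q.size)) ≤ Q.size * Q.size * (13 * (d * Q.size)) :=
        Nat.mul_le_mul_right _ h₂
    _ = 13 * (d * Q.size ^ 3) := by ring

theorem projIndex_size_lt (hd : D.totalCard < 2 ^ d) (j : Fin m) (i : Fin k) :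
    (projIndex D C j i).size < 2 ^ d := by
  refine lt_of_le_of_lt ?_ hd
  refine (projectionIndexT_size_le _ _ _).trans ((expanded_length_le D j).trans ?_)
  exact Finset.single_le_sum (f := D.card) (fun _ _ => Nat.zero_le _) (Finset.mem_univ j)

theorem verifyT_steps_le (hd₁ : 1 ≤ d) (hd : D.totalCard < 2 ^ d) (i : Fin k) (t u : Tuple Dom)
    (j : Fin m) : (verifyT D C (guardIndex D) (projIndex D C) i t u j).steps ≤
      22 * (d * Q.size ^ 3) := by
  have h₁ := rangeT_steps_le_size Q hd₁ (projIndex D C j i)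
    (C.attrs_length_le (Q.input j ⊓ C.set i.succ)) u (projIndex_size_lt hd j i)
  have h₂ : ∀ s, (expandT D (guardIndex D) s).steps ≤ 13 * (d * Q.size ^ 3) :=
    expandT_steps_le hd₁ fun f => (guardIndex_size_le D f).trans_lt hd
  have h₃ : d * Q.size ≤ d * Q.size ^ 3 :=
    Nat.mul_le_mul_left d (Nat.le_self_pow (by norm_num) _)
  have h₄ : n + 1 ≤ d * Q.size := by
    refine le_trans ?_ (Nat.le_mul_of_pos_left _ hd₁)
    unfold Query.size
    omega
  unfold verifyT
  rw [Timed.bind_steps, Timed.bind_steps, tick_steps]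
  split_ifs
  · rw [Timed.bind_steps, tick_steps, Timed.bind_steps]
    have h₅ := h₂ (joinTuple t (restrict (Q.input j ⊓ C.set i.succ).1 u))
    cases (expandT D (guardIndex D) (joinTuple t
      (restrict (Q.input j ⊓ C.set i.succ).1 u))).val with
    | none =>
      simp only [Timed.pure_steps]
      omega
    | some u' =>
      have h₆ := eqT_steps_le (List.finRange n) u' u
      rw [List.length_finRange] at h₆
      simp only
      omega
  · rw [Timed.pure_steps]
    omega

/-- The work spent on a tuple is proportional to one plus the number of its candidates, which is
bounded by each of its degrees in the covering relations. -/
theorem exists_extendT_steps_le (hcov : C.AllCovered) (hd₁ : 1 ≤ d) (hd : D.totalCard < 2 ^ d)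
    (i : Fin k) (t : Tuple Dom) :
    ∃ c : ℕ, (∀ j ∈ C.covering i, c ≤ degree D (Q.input j ⊓ C.set i.castSucc).1 t j) ∧
      1 + (extendT D C (guardIndex D) (projIndex D C) i t).steps +
        (extendT D C (guardIndex D) (projIndex D C) i t).val.length ≤
          39 * (d * Q.size ^ 4) * (1 + c) := by
  obtain ⟨j, hj, hmin, hval, hsteps⟩ := extendT_val (D := D) hcov i t
  refine ⟨(candidates D C i t j).length, fun j' hj' =>
    (hmin j' hj').trans (candidates_length_le_degree i t j'), ?_⟩
  have h₁ := hsteps _ _ _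
    (fun j' _ => rangeT_steps_le_size Q hd₁ _
      (C.attrs_length_le (Q.input j' ⊓ C.set i.castSucc)) t (projIndex_size_lt hd j' i))
    (expandT_steps_le hd₁ fun f => (guardIndex_size_le D f).trans_lt hd)
    (fun u j' => verifyT_steps_le hd₁ hd i t u j')
  have h₂ : (extendT D C (guardIndex D) (projIndex D C) i t).val.length ≤
      (candidates D C i t j).length := by
    rw [hval]
    exact List.length_filterMap_le _ _
  have hs := Q.one_le_size
  have hnm : n + m + 1 ≤ Q.size := by
    unfold Query.size
    omega
  generalize Q.size = s at *
  generalize (candidates D C i t j).length = c at *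
  have h₃ : 1 ≤ d * s ^ 4 := Nat.mul_pos hd₁ (pow_pos hs 4)
  have h₄ : s ≤ d * s ^ 4 :=
    (Nat.le_self_pow (by norm_num) s).trans (Nat.le_mul_of_pos_left _ hd₁)
  have h₅ : d * s ^ 3 ≤ d * s ^ 4 := Nat.mul_le_mul_left d (Nat.pow_le_pow_right hs (by norm_num))
  have h₆ : m * (6 * (d * s) + 1) ≤ 7 * (d * s ^ 4) :=
    calc m * (6 * (d * s) + 1) ≤ s * (6 * (d * s) + 1) := Nat.mul_le_mul_right _ (by omega)
      _ = 6 * (d * s ^ 2) + s := by ring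
      _ ≤ 6 * (d * s ^ 4) + d * s ^ 4 := by
        have : s ^ 2 ≤ s ^ 4 := Nat.pow_le_pow_right hs (by norm_num)
        gcongr
      _ = 7 * (d * s ^ 4) := by ring
  have h₇ : m * (22 * (d * s ^ 3) + 1) ≤ 23 * (d * s ^ 4) :=
    calc m * (22 * (d * s ^ 3) + 1) ≤ s * (22 * (d * s ^ 3) + 1) :=
          Nat.mul_le_mul_right _ (by omega)
      _ = 22 * (d * s ^ 4) + s := by ring
      _ ≤ 23 * (d * s ^ 4) := by omega
  have h₈ : c * (1 + (n + (13 * (d * s ^ 3) + (m + m * (22 * (d * s ^ 3) + 1)))) + 1) ≤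
      c * (38 * (d * s ^ 4)) := Nat.mul_le_mul_left c (by omega)
  have h₉ : c ≤ c * (d * s ^ 4) := Nat.le_mul_of_pos_right _ h₃
  have h₁₀ : 39 * (d * s ^ 4) * (1 + c) = 39 * (d * s ^ 4) + 39 * (c * (d * s ^ 4)) := by ring
  have h₁₁ : c * (38 * (d * s ^ 4)) = 38 * (c * (d * s ^ 4)) := by ring
  omega

theorem flatMapT_steps_le {w : Fin m → ℝ} (hcov : C.AllCovered) (hw : C.IsFractionalEdgeCover w)
    (hd₁ : 1 ≤ d) (hd : D.totalCard < 2 ^ d) (i : Fin k) (q : List (Tuple Dom)) :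
    ((flatMapT (extendT D C (guardIndex D) (projIndex D C) i) q).steps : ℝ) ≤
      78 * (d * (Q.size : ℝ) ^ 4) * (q.map (weight D C w i.castSucc)).sum := by
  rw [flatMapT_steps]
  induction q with
  | nil => simp
  | cons t q ih =>
    rw [List.map_cons, List.sum_cons, List.map_cons, List.sum_cons, Nat.cast_add, mul_add]
    refine add_le_add ?_ ih
    obtain ⟨c, hc, hsteps⟩ := exists_extendT_steps_le (D := D) hcov hd₁ hd i t
    have h₁ := le_weight hw hc
    have h₂ := one_le_weight (D := D) (C := C) hw.1 i.castSucc t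
    have h₃ : ((1 + (extendT D C (guardIndex D) (projIndex D C) i t).steps +
        (extendT D C (guardIndex D) (projIndex D C) i t).val.length : ℕ) : ℝ) ≤
        39 * (d * (Q.size : ℝ) ^ 4) * (1 + c) := by exact_mod_cast hsteps
    refine h₃.trans ?_
    have h₄ : (1 : ℝ) + c ≤ 2 * weight D C w i.castSucc t := by linarith
    calc 39 * (d * (Q.size : ℝ) ^ 4) * (1 + c)
        ≤ 39 * (d * (Q.size : ℝ) ^ 4) * (2 * weight D C w i.castSucc t) :=
          mul_le_mul_of_nonneg_left h₄ (by positivity)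
      _ = 78 * (d * (Q.size : ℝ) ^ 4) * weight D C w i.castSucc t := by ring

theorem guardIndexT_steps_le (hd₁ : 1 ≤ d) (hd : D.totalCard < 2 ^ d) (f : Fin r) :
    (guardIndexT D f).steps ≤ 4 * (d * Q.size * D.totalCard) := by
  unfold guardIndexT
  cases Q.guard f with
  | none => simp
  | some j =>
    have hN : (D.rel j).length ≤ D.totalCard :=
      Finset.single_le_sum (f := D.card) (fun _ _ => Nat.zero_le _) (Finset.mem_univ j)
    have h₁ := mergeSortT_steps_le (leT (lhsAttrs Q f)) (leT_steps_le (lhsAttrs Q f)) d (D.rel j)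
      (hN.trans hd.le)
    simp only [Timed.bind_steps, toArrayT_steps]
    rw [(mergeSortT_perm _ _).length_eq]
    have h₂ := lhsAttrs_length_le (Q := Q) f
    have h₃ : (lhsAttrs Q f).length + 2 ≤ 2 * Q.size := by
      unfold Query.size
      omega
    have h₄ : 1 ≤ d * Q.size := Nat.mul_pos hd₁ Q.one_le_size
    have h₅ : d * (D.rel j).length * ((lhsAttrs Q f).length + 2) ≤
        d * D.totalCard * (2 * Q.size) := by gcongr
    have h₆ : D.totalCard ≤ d * Q.size * D.totalCard := Nat.le_mul_of_pos_left _ h₄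
    have h₇ : d * D.totalCard * (2 * Q.size) = 2 * (d * Q.size * D.totalCard) := by ring
    omega

theorem projectionIndexT_steps_le_size (hd₁ : 1 ≤ d) (hd : D.totalCard < 2 ^ d) (j : Fin m)
    (i : Fin k) : (projectionIndexT (Q.input j ⊓ C.set i.succ).1
      (C.attrs (Q.input j ⊓ C.set i.succ)) (expanded D j)).steps ≤
        6 * (d * Q.size * D.totalCard) := by
  have hN : (expanded D j).length ≤ D.totalCard := (expanded_length_le D j).trans
    (Finset.single_le_sum (f := D.card) (fun _ _ => Nat.zero_le _) (Finset.mem_univ j))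
  have hA := C.attrs_length_le (Q.input j ⊓ C.set i.succ)
  refine (projectionIndexT_steps_le _ _ _ (hN.trans hd.le)).trans ?_
  have hn : n + 1 ≤ Q.size := by
    unfold Query.size
    omega
  generalize (C.attrs (Q.input j ⊓ C.set i.succ)).length = a at *
  calc (expanded D j).length * (n + 1) +
        ((expanded D j).length + d * (expanded D j).length * (a + 2)) +
        (expanded D j).length * (a + 1) + (expanded D j).length
      ≤ D.totalCard * Q.size + (D.totalCard * Q.size + d * D.totalCard * (2 * Q.size)) +
        D.totalCard * Q.size + D.totalCard * Q.size := by
        have h₁ : (expanded D j).length ≤ D.totalCard * Q.size :=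
          hN.trans (Nat.le_mul_of_pos_right _ Q.one_le_size)
        have h₂ : a + 2 ≤ 2 * Q.size := by omega
        have h₃ : a + 1 ≤ Q.size := by omega
        gcongr
    _ = 4 * (1 * Q.size * D.totalCard) + 2 * (d * Q.size * D.totalCard) := by ring
    _ ≤ 4 * (d * Q.size * D.totalCard) + 2 * (d * Q.size * D.totalCard) := by gcongr
    _ = 6 * (d * Q.size * D.totalCard) := by ring

end Steps

/-! ### The loop over the chain and the whole algorithm -/

section Loop

variable {n m r k : ℕ} {Q : Query n m r} {Dom : Fin n → Type} [∀ x, LinearOrder (Dom x)]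
variable (D : Database Q Dom) (C : Chain Q k)

theorem drop_finRange {p : ℕ} (hp : p < k) :
    (List.finRange k).drop p = ⟨p, hp⟩ :: (List.finRange k).drop (p + 1) := by
  rw [List.drop_eq_getElem_cons (by simpa using hp), List.getElem_finRange]
  rfl

variable {D C}

/-- Invariants of the loop hold at its end. -/
theorem levelsT_induction {G : Fin r → Array (Tuple Dom)} {I : Fin m → Fin k → Array (Tuple Dom)}
    {P : Fin (k + 1) → List (Tuple Dom) → Prop}
    (hstep : ∀ (i : Fin k) q, P i.castSucc q → P i.succ (flatMapT (extendT D C G I i) q).val)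
    {e p : ℕ} (hp : p + e = k) {q : List (Tuple Dom)} (hq : P ⟨p, by omega⟩ q) :
    P (Fin.last k) (levelsT D C G I ((List.finRange k).drop p) q).val := by
  induction e generalizing p q with
  | zero =>
    obtain rfl : p = k := hp
    rw [List.drop_of_length_le (by simp)]
    exact hq
  | succ e ih =>
    rw [drop_finRange (show p < k by omega)]
    exact ih (p := p + 1) (by omega) (hstep ⟨p, by omega⟩ q hq)

theorem levelsT_steps_le {G : Fin r → Array (Tuple Dom)} {I : Fin m → Fin k → Array (Tuple Dom)}
    {P : Fin (k + 1) → List (Tuple Dom) → Prop} {b : ℝ}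
    (hstep : ∀ (i : Fin k) q, P i.castSucc q → P i.succ (flatMapT (extendT D C G I i) q).val)
    (hb : ∀ (i : Fin k) q, P i.castSucc q → 1 + ((flatMapT (extendT D C G I i) q).steps : ℝ) ≤ b)
    {e p : ℕ} (hp : p + e = k) {q : List (Tuple Dom)} (hq : P ⟨p, by omega⟩ q) :
    ((levelsT D C G I ((List.finRange k).drop p) q).steps : ℝ) ≤ e * b := by
  induction e generalizing p q with
  | zero =>
    obtain rfl : p = k := hp
    rw [List.drop_of_length_le (by simp)]
    simp [levelsT]
  | succ e ih =>
    rw [drop_finRange (show p < k by omega)]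
    have h₁ := ih (p := p + 1) (by omega) (hstep ⟨p, by omega⟩ q hq)
    have h₂ := hb ⟨p, by omega⟩ q hq
    simp only [levelsT, Timed.bind_steps, tick_steps]
    push_cast
    linarith

variable (D C)

theorem tabulateT_expandT_val :
    (tabulateT fun j => filterMapT (expandT D (guardIndex D)) (D.rel j)).val = expanded D :=
  funext fun _ => filterMapT_val _ _

theorem chainAlgorithm_val : (chainAlgorithm D C).val =
    (levelsT D C (guardIndex D) (projIndex D C) (List.finRange k) [fun _ => ⊥]).val := by
  have h : ∀ R, R = expanded D → (levelsT D C (guardIndex D) (fun j i =>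
      (projectionIndexT (Q.input j ⊓ C.set i.succ).1 (C.attrs (Q.input j ⊓ C.set i.succ))
        (R j)).val) (List.finRange k) [fun _ => ⊥]).val =
      (levelsT D C (guardIndex D) (projIndex D C) (List.finRange k) [fun _ => ⊥]).val := by
    rintro R rfl
    rfl
  exact h _ (tabulateT_expandT_val D)

theorem chainAlgorithm_steps : (chainAlgorithm D C).steps =
    (tabulateT (guardIndexT D)).steps +
      ((tabulateT fun j => filterMapT (expandT D (guardIndex D)) (D.rel j)).steps +
      ((tabulateT fun j => tabulateT fun i : Fin k =>
        projectionIndexT (Q.input j ⊓ C.set i.succ).1 (C.attrs (Q.input j ⊓ C.set i.succ))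
          (expanded D j)).steps +
      (levelsT D C (guardIndex D) (projIndex D C) (List.finRange k) [fun _ => ⊥]).steps)) := by
  have h : ∀ R, R = expanded D → (tabulateT fun j => tabulateT fun i : Fin k =>
        projectionIndexT (Q.input j ⊓ C.set i.succ).1 (C.attrs (Q.input j ⊓ C.set i.succ))
          (R j)).steps + (levelsT D C (guardIndex D) (fun j i =>
      (projectionIndexT (Q.input j ⊓ C.set i.succ).1 (C.attrs (Q.input j ⊓ C.set i.succ))
        (R j)).val) (List.finRange k) [fun _ => ⊥]).steps =
      (tabulateT fun j => tabulateT fun i : Fin k =>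
        projectionIndexT (Q.input j ⊓ C.set i.succ).1 (C.attrs (Q.input j ⊓ C.set i.succ))
          (expanded D j)).steps +
      (levelsT D C (guardIndex D) (projIndex D C) (List.finRange k) [fun _ => ⊥]).steps := by
    rintro R rfl
    rfl
  rw [← h _ (tabulateT_expandT_val D)]
  rfl

variable {D C}

theorem isLevel_chainAlgorithm (hC : C.IsGood) (hcov : C.AllCovered) :
    IsLevel D C (Fin.last k) (chainAlgorithm D C).val := by
  rw [chainAlgorithm_val]
  exact levelsT_induction (P := IsLevel D C) (fun i q hq => hq.step hC hcov) (zero_add k)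
    (isLevel_zero D C)

theorem levelsT_steps_le_prod {w : Fin m → ℝ} {d : ℕ} (hC : C.IsGood) (hcov : C.AllCovered)
    (hw : C.IsFractionalEdgeCover w) (hne : ∀ j, D.rel j ≠ []) (hd₁ : 1 ≤ d)
    (hd : D.totalCard < 2 ^ d) :
    ((levelsT D C (guardIndex D) (projIndex D C) (List.finRange k) [fun _ => ⊥]).steps : ℝ) ≤
      k * (1 + 78 * (d * (Q.size : ℝ) ^ 4) * ∏ j, (D.card j : ℝ) ^ w j) := by
  refine levelsT_steps_le (P := fun i q => IsLevel D C i q ∧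
    (q.map (weight D C w i)).sum ≤ ∏ j, (D.card j : ℝ) ^ w j) (fun i q hq => ?_) (fun i q hq => ?_)
    (zero_add k) ⟨isLevel_zero D C, ?_⟩
  · exact ⟨hq.1.step hC hcov, (sum_weight_flatMapT_le hC hcov hw hq.1.sound).trans hq.2⟩
  · refine add_le_add_right ((flatMapT_steps_le hcov hw hd₁ hd i q).trans ?_) 1
    exact mul_le_mul_of_nonneg_left hq.2 (by positivity)
  · rw [List.map_singleton, List.sum_singleton]
    exact weight_zero_le hne hw.1 _

theorem preprocessing_steps_le {d : ℕ} (hd₁ : 1 ≤ d) (hd : D.totalCard < 2 ^ d) :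
    (tabulateT (guardIndexT D)).steps +
      ((tabulateT fun j => filterMapT (expandT D (guardIndex D)) (D.rel j)).steps +
      (tabulateT fun j => tabulateT fun i : Fin k =>
        projectionIndexT (Q.input j ⊓ C.set i.succ).1 (C.attrs (Q.input j ⊓ C.set i.succ))
          (expanded D j)).steps) ≤ 24 * (d * Q.size ^ 5 * (D.totalCard + 1)) := by
  have h₁ := tabulateT_steps_le _ (guardIndexT_steps_le (D := D) hd₁ hd)
  have h₂ := tabulateT_steps_le
    (fun j => filterMapT (expandT D (guardIndex D)) (D.rel j)) fun j =>
      (filterMapT_steps_le _ (D.rel j) fun t _ =>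
        expandT_steps_le hd₁ (fun f => (guardIndex_size_le D f).trans_lt hd) t).trans
      (Nat.mul_le_mul_right _ (Finset.single_le_sum (f := D.card) (fun _ _ => Nat.zero_le _)
        (Finset.mem_univ j)))
  have h₃ := tabulateT_steps_le (fun j => tabulateT fun i : Fin k =>
    projectionIndexT (Q.input j ⊓ C.set i.succ).1 (C.attrs (Q.input j ⊓ C.set i.succ))
      (expanded D j)) fun j => tabulateT_steps_le _
        (projectionIndexT_steps_le_size (D := D) (C := C) hd₁ hd j)
  refine (add_le_add h₁ (add_le_add h₂ h₃)).trans ?_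
  change r * (4 * (d * Q.size * D.totalCard) + 1) +
    (m * (D.totalCard * (13 * (d * Q.size ^ 3) + 1) + 1) +
      m * (k * (6 * (d * Q.size * D.totalCard) + 1) + 1)) ≤ _
  have hr : r ≤ Q.size := by
    unfold Query.size
    omega
  have hm : m ≤ Q.size := by
    unfold Query.size
    omega
  have hk : k ≤ Q.size := C.length_le.trans (by unfold Query.size; omega)
  have hs := Q.one_le_size
  generalize Q.size = s at *
  generalize D.totalCard = N at *
  have hp : ∀ e ≤ 5, s ^ e ≤ d * s ^ 5 := fun e he =>
    (Nat.pow_le_pow_right hs he).trans (Nat.le_mul_of_pos_left _ hd₁)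
  have hp' : ∀ e ≤ 5, d * s ^ e * N ≤ d * s ^ 5 * N := fun e he =>
    Nat.mul_le_mul_right N (Nat.mul_le_mul_left d (Nat.pow_le_pow_right hs he))
  have hp'' : s * N ≤ d * s ^ 5 * N := Nat.mul_le_mul_right N (by simpa using hp 1 (by norm_num))
  calc r * (4 * (d * s * N) + 1) + (m * (N * (13 * (d * s ^ 3) + 1) + 1) +
        m * (k * (6 * (d * s * N) + 1) + 1))
      ≤ s * (4 * (d * s * N) + 1) + (s * (N * (13 * (d * s ^ 3) + 1) + 1) +
        s * (s * (6 * (d * s * N) + 1) + 1)) := by gcongr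
    _ = 4 * (d * s ^ 2 * N) + 13 * (d * s ^ 4 * N) + s * N + 6 * (d * s ^ 3 * N) +
        (3 * s ^ 1 + s ^ 2) := by ring
    _ ≤ 4 * (d * s ^ 5 * N) + 13 * (d * s ^ 5 * N) + d * s ^ 5 * N + 6 * (d * s ^ 5 * N) +
        (3 * (d * s ^ 5) + d * s ^ 5) := by
      refine add_le_add (add_le_add (add_le_add (add_le_add ?_ ?_) hp'') ?_)
        (add_le_add ?_ (hp 2 (by norm_num)))
      · exact Nat.mul_le_mul_left 4 (hp' 2 (by norm_num))
      · exact Nat.mul_le_mul_left 13 (hp' 4 (by norm_num))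
      · exact Nat.mul_le_mul_left 6 (hp' 3 (by norm_num))
      · exact Nat.mul_le_mul_left 3 (hp 1 (by norm_num))
    _ ≤ 24 * (d * s ^ 5 * (N + 1)) := by
      rw [mul_add (d * s ^ 5)]
      omega

theorem chainAlgorithm_steps_le {w : Fin m → ℝ} (hC : C.IsGood) (hcov : C.AllCovered)
    (hw : C.IsFractionalEdgeCover w) (hne : ∀ j, D.rel j ≠ []) :
    ((chainAlgorithm D C).steps : ℝ) ≤
      103 * (Q.size : ℝ) ^ 5 * (1 + Real.logb 2 (1 + (D.totalCard : ℝ))) *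
        ((D.totalCard : ℝ) + ∏ j, (D.card j : ℝ) ^ w j) := by
  set d := Nat.log 2 D.totalCard + 1 with hd
  have hd₁ : 1 ≤ d := Nat.le_add_left 1 _
  have hlt : D.totalCard < 2 ^ d := Nat.lt_pow_succ_log_self (by norm_num) _
  have h₁ := levelsT_steps_le_prod hC hcov hw hne hd₁ hlt
  have h₂ := preprocessing_steps_le (C := C) hd₁ hlt
  have hP : (1 : ℝ) ≤ ∏ j, (D.card j : ℝ) ^ w j := Finset.one_le_prod fun j _ =>
    Real.one_le_rpow (Nat.one_le_cast.2 (List.length_pos_iff.2 (hne j))) (hw.1 j)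
  have hdlog : (d : ℝ) ≤ 1 + Real.logb 2 (1 + (D.totalCard : ℝ)) := by
    rw [hd, Nat.cast_add, Nat.cast_one, add_comm]
    refine add_le_add_right ?_ 1
    refine (Nat.cast_le.2 (Nat.log_mono_right (Nat.le_succ D.totalCard))).trans ?_
    have := Real.natLog_le_logb (D.totalCard + 1) 2
    rw [add_comm (1 : ℝ)]
    exact_mod_cast this
  have hs : (1 : ℝ) ≤ Q.size := by exact_mod_cast Q.one_le_size
  have hk : (k : ℝ) ≤ Q.size := by
    refine Nat.cast_le.2 (C.length_le.trans ?_)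
    unfold Query.size
    omega
  have hd₁' : (1 : ℝ) ≤ d := by exact_mod_cast hd₁
  rw [chainAlgorithm_steps, ← add_assoc, ← add_assoc, add_assoc (tabulateT _).steps, Nat.cast_add]
  have h₃ := add_le_add (Nat.cast_le (α := ℝ).2 h₂) h₁
  refine h₃.trans ?_
  generalize (∏ j, (D.card j : ℝ) ^ w j) = P at *
  generalize (Q.size : ℕ) = s at *
  push_cast
  have hN : (0 : ℝ) ≤ D.totalCard := Nat.cast_nonneg _
  have h₄ : (k : ℝ) * (1 + 78 * (d * (s : ℝ) ^ 4) * P) ≤ 79 * (d * (s : ℝ) ^ 5 * P) := by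
    have h₅ : (1 : ℝ) ≤ d * (s : ℝ) ^ 4 * P :=
      one_le_mul_of_one_le_of_one_le
        (one_le_mul_of_one_le_of_one_le hd₁' (one_le_pow₀ hs)) hP
    calc (k : ℝ) * (1 + 78 * (d * (s : ℝ) ^ 4) * P)
        ≤ s * (d * (s : ℝ) ^ 4 * P + 78 * (d * (s : ℝ) ^ 4) * P) := by gcongr
      _ = 79 * (d * (s : ℝ) ^ 5 * P) := by ring
  calc 24 * (d * (s : ℝ) ^ 5 * (D.totalCard + 1)) + k * (1 + 78 * (d * (s : ℝ) ^ 4) * P)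
      ≤ 24 * (d * (s : ℝ) ^ 5 * (D.totalCard + P)) + 79 * (d * (s : ℝ) ^ 5 * P) := by gcongr
    _ ≤ 24 * (d * (s : ℝ) ^ 5 * (D.totalCard + P)) +
        79 * (d * (s : ℝ) ^ 5 * (D.totalCard + P)) := by
        gcongr
        exact le_add_of_nonneg_left hN
    _ = 103 * (s : ℝ) ^ 5 * d * (D.totalCard + P) := by ring
    _ ≤ 103 * (s : ℝ) ^ 5 * (1 + Real.logb 2 (1 + (D.totalCard : ℝ))) *
        (D.totalCard + P) := by gcongr

end Loop

end ChainJoin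

theorem mainTheorem3 :
    ∃ c : ℕ, ∀ (n m r k : ℕ) (Q : ChainJoin.Query n m r) (C : ChainJoin.Chain Q k),
      C.IsGood → C.AllCovered →
      ∀ (Dom : Fin n → Type) [∀ x, LinearOrder (Dom x)] (D : ChainJoin.Database Q Dom),
        (∀ j, D.rel j ≠ []) →
        ((ChainJoin.chainAlgorithm D C).val.Nodup ∧
          {t | t ∈ (ChainJoin.chainAlgorithm D C).val} = ChainJoin.ofTotal '' D.answer) ∧
        ∀ w : Fin m → ℝ, C.IsFractionalEdgeCover w →
          ((ChainJoin.chainAlgorithm D C).steps : ℝ) ≤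
            c * (Q.size : ℝ) ^ c * (1 + Real.logb 2 (1 + (D.totalCard : ℝ))) *
              ((D.totalCard : ℝ) + ∏ j, (D.card j : ℝ) ^ w j) := by
  refine ⟨103, fun n m r k Q C hC hcov Dom _ D hne => ?_⟩
  have hlevel := ChainJoin.isLevel_chainAlgorithm (D := D) hC hcov
  refine ⟨⟨hlevel.nodup, hlevel.eq_answer hne⟩, fun w hw => ?_⟩
  refine (ChainJoin.chainAlgorithm_steps_le hC hcov hw hne).trans ?_
  have hs : (1 : ℝ) ≤ Q.size := by exact_mod_cast Q.one_le_size
  have hlog : 0 ≤ Real.logb 2 (1 + (D.totalCard : ℝ)) :=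
    Real.logb_nonneg (by norm_num) (le_add_of_nonneg_right (Nat.cast_nonneg _))
  have hP : 0 ≤ ∏ j, (D.card j : ℝ) ^ w j :=
    Finset.prod_nonneg fun j _ => Real.rpow_nonneg (Nat.cast_nonneg _) _
  have hpow : (Q.size : ℝ) ^ 5 ≤ (Q.size : ℝ) ^ 103 := pow_le_pow_right₀ hs (by norm_num)
  rw [Nat.cast_ofNat]
  gcongr
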